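/- Theorem (Macdonald, 1898; Whittaker, 1935). Let $\Gamma \subset \mathbb{C}$ be a contour, that is, a simple closed (Jordan) curve, and let $D$ be the bounded region enclosed by $\Gamma$, that is, the bounded connected component of $\mathbb{C} \setminus \Gamma$. Let $f$ be a complex-valued function that is continuous on $D \cup \Gamma$, analytic in $D$ and not constant in $D$, and suppose that for some constant $C$ we have $|f(z)| = C$ at every point $z$ of $\Gamma$. Then $f$ and $f'$ have only finitely many zeros in $D$, and, when zeros are counted according to their multiplicity, the number of zeros of $f$ in $D$ exceeds the number of zeros of $f'$ in $D$ by exactly one. -/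

import Mathlib

namespace Macdonald

/-- A contour: a simple closed (Jordan) curve in the plane, that is, the image of the unit circle
under a continuous injective map. No smoothness is required. -/
def IsContour (Γ : Set ℂ) : Prop :=
  ∃ γ : Circle → ℂ, Continuous γ ∧ Function.Injective γ ∧ Set.range γ = Γ

/-- `D` is the bounded region enclosed by the contour `Γ`: a bounded connected component of the
complement of `Γ`. (By the Jordan curve theorem, exactly one component is bounded.) -/
def IsRegionEnclosedBy (D Γ : Set ℂ) : Prop :=
  (∃ z ∈ Γᶜ, D = connectedComponentIn Γᶜ z) ∧ Bornology.IsBounded D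

/-- The zeros of `f` in `D`. -/
def zeroSet (f : ℂ → ℂ) (D : Set ℂ) : Set ℂ := {z | z ∈ D ∧ f z = 0}

/-- The number of zeros of `f` in `D`, each zero being counted as often as its multiplicity (its
order of vanishing). Meaningful when `f` is analytic in `D` with finitely many zeros there. -/
noncomputable def zeroCount (f : ℂ → ℂ) (D : Set ℂ) : ℕ :=
  ∑ᶠ z ∈ zeroSet f D, analyticOrderNatAt f z

end Macdonald

/-!
Let `D` be the bounded region. The proof transports `f` to the unit disc by a Riemann map and counts
critical points there.

*The domain.* `D` is a component of the complement of a compact connected set `Γ`. The closure of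
every other component meets `Γ`, so `Dᶜ` is connected (`isPreconnected_compl_component`), and the
frontier of `D` lies in `Γ`. The Jordan curve theorem is not needed.

*Cauchy's theorem on `D`.* For a compact `K ⊆ D` with connected complement, the spectrum of the
coordinate function in the Banach algebra of uniform limits of polynomials on `K` is `K`, so this
algebra contains the functions `1 / (w - z)` with `w ∉ K`. Together with the Cauchy–Pompeiu formula,
applied to the product of a holomorphic function and a cutoff, this gives Runge's theorem
(`exists_polynomial_near`). Polynomials have primitives, hence so do their locally uniform limits,
and nonvanishing holomorphic functions on `D` have holomorphic square roots (`exists_sq_eq`).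

*The Riemann map.* Square roots are all that is needed for the extremal proof of the Riemann mapping
theorem (`exists_isDiscEmbedding_bijOn`): among conformal embeddings of `D` into the disc sending
`a` to `0`, one with maximal `‖g' a‖` is onto. Compactness comes from limits along an ultrafilter,
which are locally uniform because bounded holomorphic functions are locally equi-Lipschitz.

*The disc.* With `φ : D → 𝔻` the Riemann map, `g = f ∘ φ⁻¹` has modulus tending to `C > 0` at the
unit circle. Dividing by the finite Blaschke product `B` with the same zeros and using the maximum
principle for the quotient and its inverse, `g` is a constant multiple of `B`
(`exists_eq_blaschke`). On the unit circle `z B' / B` is a sum of Poisson kernels, hence positive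
(`eval_blaschkeWronskian`), so by the argument principle `z B'` and `B` have equally many zeros in
the disc (`countP_roots_blaschkeWronskian`); the factor `z` accounts for the difference of one.
Since `φ` is conformal, orders of vanishing of `f` and `f'` agree with those of `g` and `g'`.
-/

namespace Macdonald

open Set Filter Topology Metric MeasureTheory Complex
open scoped ComplexConjugate

/-! ### The complement of a bounded component -/

lemma closure_component_subset {Γ : Set ℂ} (hΓ : IsClosed Γ) (z : ℂ) :
    closure (connectedComponentIn Γᶜ z) ⊆ connectedComponentIn Γᶜ z ∪ Γ := by
  intro w hw
  by_cases hwΓ : w ∈ Γ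
  · exact Or.inr hwΓ
  left
  have ho : IsOpen (connectedComponentIn Γᶜ w) := hΓ.isOpen_compl.connectedComponentIn
  obtain ⟨v, hv1, hv2⟩ := mem_closure_iff.1 hw _ ho (mem_connectedComponentIn hwΓ)
  rw [connectedComponentIn_eq hv2, ← connectedComponentIn_eq hv1]
  exact mem_connectedComponentIn hwΓ

/-- The complement of a component of the complement of a nonempty connected closed set is
connected, since the closure of every other component meets that set. -/
lemma isPreconnected_compl_component {Γ : Set ℂ} (hΓ : IsClosed Γ) (hΓc : IsPreconnected Γ)
    (hΓn : Γ.Nonempty) (z : ℂ) : IsPreconnected (connectedComponentIn Γᶜ z)ᶜ := by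
  obtain ⟨b, hb⟩ := hΓn
  have hΓD : Γ ⊆ (connectedComponentIn Γᶜ z)ᶜ := fun w hw h =>
    connectedComponentIn_subset _ _ h hw
  refine isPreconnected_of_forall b fun w hw => ?_
  by_cases hwΓ : w ∈ Γ
  · exact ⟨Γ, hΓD, hb, hwΓ, hΓc⟩
  set E := connectedComponentIn Γᶜ w with hE
  have hwE : w ∈ E := mem_connectedComponentIn hwΓ
  have hEsub : E ⊆ (connectedComponentIn Γᶜ z)ᶜ := by
    intro v hv hv'
    apply hw
    rw [connectedComponentIn_eq hv', ← connectedComponentIn_eq hv]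
    exact hwE
  obtain ⟨c, hcE, hcΓ⟩ : (closure E ∩ Γ).Nonempty := by
    by_contra h
    rw [not_nonempty_iff_eq_empty] at h
    have hcl : closure E ⊆ E := fun v hv =>
      (closure_component_subset hΓ w hv).resolve_right fun hvΓ => h.subset ⟨hv, hvΓ⟩
    have : IsClopen E := ⟨isClosed_of_closure_subset hcl, hΓ.isOpen_compl.connectedComponentIn⟩
    have hEu := this.eq_univ ⟨w, hwE⟩
    exact connectedComponentIn_subset Γᶜ w (hEu ▸ mem_univ b : b ∈ E) hb
  refine ⟨closure E ∪ Γ, union_subset ?_ hΓD, Or.inr hb, Or.inl (subset_closure hwE),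
    isPreconnected_connectedComponentIn.closure.union c hcE hcΓ hΓc⟩
  intro v hv
  exact (closure_component_subset hΓ w hv).elim (fun h => hEsub h) (fun h => hΓD h)

/-! ### The Cauchy–Pompeiu formula -/

lemma integral_div_sq_add_sq (L : ℝ) (hL : 0 < L) (c : ℝ) :
    ∫ x in (c - L)..(c + L), L / ((x - c) ^ 2 + L ^ 2) = Real.pi / 2 := by
  have h : ∀ x : ℝ, HasDerivAt (fun x : ℝ => Real.arctan ((x - c) / L))
      (L / ((x - c) ^ 2 + L ^ 2)) x := by
    intro x
    have := (((hasDerivAt_id x).sub_const c).div_const L).arctan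
    refine this.congr_deriv ?_
    simp only [id]
    field_simp
    ring
  rw [intervalIntegral.integral_eq_sub_of_hasDerivAt (fun x _ => h x)]
  · have h1 : (c + L - c) / L = 1 := by field_simp; ring
    have h2 : (c - L - c) / L = -1 := by field_simp; ring
    rw [h1, h2, Real.arctan_neg, Real.arctan_one]; ring
  · apply Continuous.intervalIntegrable
    apply Continuous.div (by fun_prop) (by fun_prop)
    intro x; positivity

/-- The boundary integral of `1 / (w - z)` over a square centred at `z` is `2πi`. -/
lemma boundary_integral_inv_sub_square (z : ℂ) (L : ℝ) (hL : 0 < L) :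
    (∫ x : ℝ in (z.re - L)..(z.re + L), ((x + (z.im - L : ℝ) * I : ℂ) - z)⁻¹) -
      (∫ x : ℝ in (z.re - L)..(z.re + L), ((x + (z.im + L : ℝ) * I : ℂ) - z)⁻¹) +
      I * (∫ y : ℝ in (z.im - L)..(z.im + L), (((z.re + L : ℝ) + y * I : ℂ) - z)⁻¹) -
      I * ∫ y : ℝ in (z.im - L)..(z.im + L), (((z.re - L : ℝ) + y * I : ℂ) - z)⁻¹ =
    2 * Real.pi * I := by
  have hne : ∀ x : ℝ, ((x : ℂ) ^ 2 + (L : ℂ) ^ 2) ≠ 0 := by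
    intro x
    have : (x ^ 2 + L ^ 2 : ℝ) ≠ 0 := by positivity
    exact_mod_cast this
  have hz : z = z.re + z.im * I := (re_add_im z).symm
  have key : ∀ a b : ℂ, a ^ 2 + b ^ 2 ≠ 0 → a + b * I ≠ 0 := by
    intro a b h h'
    apply h
    have : a ^ 2 + b ^ 2 = (a + b * I) * (a - b * I) := by ring_nf; simp
    rw [this, h', zero_mul]
  have keyinv : ∀ a b : ℂ, a ^ 2 + b ^ 2 ≠ 0 → (a + b * I)⁻¹ = (a - b * I) / (a ^ 2 + b ^ 2) := by
    intro a b h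
    rw [inv_eq_one_div, div_eq_div_iff (key a b h) h]
    ring_nf; simp
  have c1 : ∀ s : ℝ, s ^ 2 = L ^ 2 → ∀ x : ℝ,
      ((x + (z.im + s : ℝ) * I : ℂ) - z)⁻¹ =
        ((x - z.re : ℝ) - s * I) / ((x - z.re : ℝ) ^ 2 + L ^ 2) := by
    intro s hs x
    have hs' : (s : ℂ) ^ 2 = (L : ℂ) ^ 2 := by exact_mod_cast hs
    have : ((x + (z.im + s : ℝ) * I : ℂ) - z) = (x - z.re : ℝ) + s * I := by
      push_cast
      linear_combination -hz
    rw [this, keyinv, hs']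
    rw [hs']; exact hne _
  have c2 : ∀ s : ℝ, s ^ 2 = L ^ 2 → ∀ y : ℝ,
      (((z.re + s : ℝ) + y * I : ℂ) - z)⁻¹ =
        (s - (y - z.im : ℝ) * I) / ((y - z.im : ℝ) ^ 2 + L ^ 2) := by
    intro s hs x
    have hs' : (s : ℂ) ^ 2 = (L : ℂ) ^ 2 := by exact_mod_cast hs
    have : (((z.re + s : ℝ) + x * I : ℂ) - z) = s + (x - z.im : ℝ) * I := by
      push_cast
      linear_combination -hz
    rw [this, keyinv, hs', add_comm ((L : ℂ) ^ 2)]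
    rw [hs', add_comm]; exact hne _
  have m1 : z.im - L = z.im + (-L) := by ring
  have m2 : z.re - L = z.re + (-L) := by ring
  have ii : ∀ (c : ℝ) (g : ℝ → ℂ) (a b : ℝ), Continuous g → IntervalIntegrable
      (fun x => g x / (((x - c : ℝ) : ℂ) ^ 2 + (L : ℂ) ^ 2)) volume a b := by
    intro c g a b hg
    apply Continuous.intervalIntegrable
    exact hg.div (by fun_prop) (fun x => hne _)
  have e1 : (∫ x : ℝ in (z.re - L)..(z.re + L), ((x + (z.im - L : ℝ) * I : ℂ) - z)⁻¹) -
      (∫ x : ℝ in (z.re - L)..(z.re + L), ((x + (z.im + L : ℝ) * I : ℂ) - z)⁻¹) = Real.pi * I := by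
    rw [m1]
    simp_rw [c1 (-L) (by ring), c1 L rfl]
    rw [← intervalIntegral.integral_sub (ii _ _ _ _ (by fun_prop)) (ii _ _ _ _ (by fun_prop))]
    have : ∀ x : ℝ, (((x - z.re : ℝ) : ℂ) - (-L : ℝ) * I) / ((x - z.re : ℝ) ^ 2 + L ^ 2) -
        (((x - z.re : ℝ) : ℂ) - L * I) / ((x - z.re : ℝ) ^ 2 + L ^ 2) =
        ((L / ((x - z.re) ^ 2 + L ^ 2) : ℝ) : ℂ) * (2 * I) := by
      intro x
      push_cast
      ring
    simp_rw [this]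
    rw [intervalIntegral.integral_mul_const, intervalIntegral.integral_ofReal,
      integral_div_sq_add_sq L hL]
    push_cast; ring
  have e2 : (∫ y : ℝ in (z.im - L)..(z.im + L), (((z.re + L : ℝ) + y * I : ℂ) - z)⁻¹) -
      (∫ y : ℝ in (z.im - L)..(z.im + L), (((z.re - L : ℝ) + y * I : ℂ) - z)⁻¹) = Real.pi := by
    rw [m2]
    simp_rw [c2 (-L) (by ring), c2 L rfl]
    rw [← intervalIntegral.integral_sub (ii _ _ _ _ (by fun_prop)) (ii _ _ _ _ (by fun_prop))]
    have : ∀ x : ℝ, ((L : ℂ) - (x - z.im : ℝ) * I) / ((x - z.im : ℝ) ^ 2 + L ^ 2) -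
        (((-L : ℝ) : ℂ) - (x - z.im : ℝ) * I) / ((x - z.im : ℝ) ^ 2 + L ^ 2) =
        ((L / ((x - z.im) ^ 2 + L ^ 2) : ℝ) : ℂ) * 2 := by
      intro x
      push_cast
      ring
    simp_rw [this]
    rw [intervalIntegral.integral_mul_const, intervalIntegral.integral_ofReal,
      integral_div_sq_add_sq L hL]
    push_cast; ring
  rw [e1, add_sub_assoc, ← mul_sub, e2]
  ring

/-- Twice `i` times the `∂̄`-derivative of `F`. -/
noncomputable def dbar (F : ℂ → ℂ) (w : ℂ) : ℂ := I * fderiv ℝ F w 1 - fderiv ℝ F w I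

lemma dbar_eq_zero {F : ℂ → ℂ} {w : ℂ} (h : DifferentiableAt ℂ F w) : dbar F w = 0 := by
  have h1 := h.hasFDerivAt.restrictScalars ℝ
  rw [dbar, h1.fderiv]
  simp only [ContinuousLinearMap.coe_restrictScalars']
  have : (fderiv ℂ F w) I = I * fderiv ℂ F w 1 := by
    conv_lhs => rw [← mul_one I, ← smul_eq_mul, map_smul, smul_eq_mul]
  rw [this, sub_self]

lemma continuous_dbar {F : ℂ → ℂ} (hF : ContDiff ℝ 1 F) : Continuous (dbar F) := by
  have := hF.continuous_fderiv one_ne_zero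
  unfold dbar
  fun_prop

lemma dbar_eq_zero_of_notMem_tsupport {F : ℂ → ℂ} {w : ℂ} (h : w ∉ tsupport F) :
    dbar F w = 0 := by
  have : fderiv ℝ F w = 0 := by
    by_contra h'
    exact h (support_fderiv_subset ℝ h')
  simp [dbar, this]

lemma hasCompactSupport_dbar {F : ℂ → ℂ} (hF : HasCompactSupport F) :
    HasCompactSupport (dbar F) :=
  HasCompactSupport.intro hF (fun _ h => dbar_eq_zero_of_notMem_tsupport h)

lemma continuous_dbar_div_sub {F : ℂ → ℂ} (hF : ContDiff ℝ 1 F) {z : ℂ}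
    (hz : ∀ᶠ w in 𝓝 z, DifferentiableAt ℂ F w) : Continuous fun w => dbar F w / (w - z) := by
  rw [continuous_iff_continuousAt]
  intro w
  by_cases h : w = z
  · subst h
    have : (fun v => dbar F v / (v - w)) =ᶠ[𝓝 w] fun _ => 0 := by
      filter_upwards [hz] with v hv
      rw [dbar_eq_zero hv, zero_div]
    exact continuousAt_const.congr this.symm
  · exact (continuous_dbar hF).continuousAt.div (by fun_prop) (sub_ne_zero.2 h)

/-- Cauchy–Pompeiu formula for a compactly supported function, at a point near which it is
holomorphic. Green's formula on a large square is applied to the difference quotient of `F` at `z`,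
which equals `-F z / (w - z)` on the boundary of the square. -/
theorem integral_dbar_div_sub {F : ℂ → ℂ} (hF : ContDiff ℝ 1 F) (hFs : HasCompactSupport F)
    {z : ℂ} (hz : ∀ᶠ w in 𝓝 z, DifferentiableAt ℂ F w) :
    ∫ w, dbar F w / (w - z) = -(2 * Real.pi * I) * F z := by
  obtain ⟨R, hR⟩ := hFs.isBounded.subset_closedBall z
  set L : ℝ := |R| + 1 with hLdef
  have hL : 0 < L := by positivity
  have hout : ∀ w, L ≤ dist w z → w ∉ tsupport F := by
    intro w hw h
    have := hR h
    rw [mem_closedBall] at this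
    have := le_abs_self R
    linarith
  have hF0 : ∀ w, L ≤ dist w z → F w = 0 := fun w hw =>
    image_eq_zero_of_notMem_tsupport (hout w hw)
  have hk0 : ∀ w, L ≤ dist w z → dbar F w = 0 := fun w hw =>
    dbar_eq_zero_of_notMem_tsupport (hout w hw)
  have hdx : ∀ x y : ℝ, |x - z.re| ≤ dist (x + y * I : ℂ) z := by
    intro x y
    rw [dist_eq_norm]
    simpa using abs_re_le_norm ((x + y * I : ℂ) - z)
  have hdy : ∀ x y : ℝ, |y - z.im| ≤ dist (x + y * I : ℂ) z := by
    intro x y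
    rw [dist_eq_norm]
    simpa using abs_im_le_norm ((x + y * I : ℂ) - z)
  have hcont := continuous_dbar_div_sub hF hz
  have hsupp : HasCompactSupport fun w => dbar F w / (w - z) :=
    (hasCompactSupport_dbar hFs).mono' fun w hw => subset_closure fun h => hw (by simp [h])
  have hint : Integrable fun w => dbar F w / (w - z) := hcont.integrable_of_hasCompactSupport hsupp
  have hdiff : Differentiable ℝ F := hF.differentiable one_ne_zero
  -- the difference quotient of `F` at `z` and its real derivative
  let G : ℂ → ℂ := dslope F z
  let G' : ℂ → ℂ →L[ℝ] ℂ := fun w =>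
    ((w - z)⁻¹ : ℂ) • fderiv ℝ F w -
      (((w - z) ^ 2)⁻¹ * (F w - F z) : ℂ) • ContinuousLinearMap.id ℝ ℂ
  have hGd : ∀ w, w ≠ z → HasFDerivAt G (G' w) w := by
    intro w hw
    have hwz : w - z ≠ 0 := sub_ne_zero.2 hw
    have h1 : HasFDerivAt (fun w => (w - z)⁻¹)
        (-(((w - z) ^ 2)⁻¹ : ℂ) • ContinuousLinearMap.id ℝ ℂ) w := by
      have :=
        ((hasDerivAt_inv hwz).comp w ((hasDerivAt_id w).sub_const z)).hasFDerivAt.restrictScalars ℝ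
      refine this.congr_fderiv ?_
      ext v; simp [mul_comm]
    have h2 : HasFDerivAt (fun w => F w - F z) (fderiv ℝ F w) w :=
      (hdiff w).hasFDerivAt.sub_const _
    have h3 := h1.mul h2
    have h4 : (fun w => (w - z)⁻¹ * (F w - F z)) =ᶠ[𝓝 w] G := by
      filter_upwards [isOpen_ne.mem_nhds hw] with v hv
      simp [G, dslope_of_ne _ hv, slope_def_field, div_eq_inv_mul]
    refine (h3.congr_of_eventuallyEq h4.symm).congr_fderiv ?_
    ext v; simp [G', smul_eq_mul]; ring
  have hGk : ∀ w, I • G' w 1 - G' w I = dbar F w / (w - z) := by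
    intro w
    simp only [G', dbar, smul_eq_mul, sub_apply, smul_apply,
      ContinuousLinearMap.id_apply, div_eq_mul_inv]
    ring
  have hGc : Continuous G := by
    rw [continuous_iff_continuousAt]
    intro w
    by_cases h : w = z
    · subst h
      exact continuousAt_dslope_same.2 hz.self_of_nhds
    · exact (hGd w h).continuousAt
  have hGb : ∀ w, L ≤ dist w z → G w = -F z * (w - z)⁻¹ := by
    intro w hw
    have hne : w ≠ z := by rintro rfl; simp at hw; linarith
    simp [G, dslope_of_ne _ hne, slope_def_field, hF0 w hw, div_eq_mul_inv]
  have key := integral_boundary_rect_of_hasFDerivAt_real_off_countable G G'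
    ⟨z.re - L, z.im - L⟩ ⟨z.re + L, z.im + L⟩ {z} (countable_singleton z) hGc.continuousOn
    (fun w hw => hGd w (by simpa using hw.2))
    (by simp_rw [hGk]; exact hint.integrableOn)
  simp only [hGk] at key
  have b1 : ∀ x : ℝ, G (x + (z.im - L : ℝ) * I) = -F z * ((x + (z.im - L : ℝ) * I : ℂ) - z)⁻¹ :=
    fun x => hGb _ ((by rw [sub_sub_cancel_left, abs_neg]; exact le_abs_self L :
      L ≤ |z.im - L - z.im|).trans (hdy _ _))
  have b2 : ∀ x : ℝ, G (x + (z.im + L : ℝ) * I) = -F z * ((x + (z.im + L : ℝ) * I : ℂ) - z)⁻¹ :=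
    fun x => hGb _ ((by rw [add_sub_cancel_left]; exact le_abs_self L :
      L ≤ |z.im + L - z.im|).trans (hdy _ _))
  have b3 : ∀ x : ℝ, G ((z.re + L : ℝ) + x * I) = -F z * (((z.re + L : ℝ) + x * I : ℂ) - z)⁻¹ :=
    fun x => hGb _ ((by rw [add_sub_cancel_left]; exact le_abs_self L :
      L ≤ |z.re + L - z.re|).trans (hdx _ _))
  have b4 : ∀ x : ℝ, G ((z.re - L : ℝ) + x * I) = -F z * (((z.re - L : ℝ) + x * I : ℂ) - z)⁻¹ :=
    fun x => hGb _ ((by rw [sub_sub_cancel_left, abs_neg]; exact le_abs_self L :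
      L ≤ |z.re - L - z.re|).trans (hdx _ _))
  simp only [b1, b2, b3, b4, intervalIntegral.integral_const_mul] at key
  have hbd := boundary_integral_inv_sub_square z L hL
  have hIoc : ∀ c t : ℝ, t ∉ Ioc (c - L) (c + L) → L ≤ |t - c| := by
    intro c t ht
    rw [le_abs]
    rw [mem_Ioc, not_and_or] at ht
    rcases ht with h | h
    · right; linarith
    · left; linarith
  have hfub : ∫ w, dbar F w / (w - z) =
      ∫ x : ℝ, ∫ y : ℝ, dbar F (x + y * I) / ((x + y * I) - z) := by
    have hmp := volume_preserving_equiv_real_prod.symm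
    rw [← hmp.integral_comp' (g := fun w => dbar F w / (w - z)), Measure.volume_eq_prod,
      integral_prod]
    · simp [measurableEquivRealProd_symm_apply, mk_eq_add_mul_I]
    · exact (hmp.integrable_comp_emb (MeasurableEquiv.measurableEmbedding _)).2 hint
  have hrhs : (∫ x : ℝ in (z.re - L)..(z.re + L), ∫ y : ℝ in (z.im - L)..(z.im + L),
      dbar F (x + y * I) / ((x + y * I) - z)) = ∫ w, dbar F w / (w - z) := by
    rw [hfub, intervalIntegral.integral_eq_integral_of_support_subset]
    · refine integral_congr_ae (Eventually.of_forall fun x => ?_)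
      simp only
      rw [intervalIntegral.integral_eq_integral_of_support_subset]
      intro y hy
      by_contra h
      exact hy (by simp [hk0 _ ((hIoc _ _ h).trans (hdy x y))])
    · intro x hx
      by_contra h
      refine hx ?_
      simp [hk0 _ ((hIoc _ _ h).trans (hdx x _))]
  rw [← hrhs, ← key]
  simp only [smul_eq_mul]
  linear_combination (-F z) * hbd

/-! ### Runge's theorem -/

/-- Uniform limits of polynomials on a compact set `K` whose complement is connected contain the
functions `1 / (w - z)` with `w ∉ K`: the spectrum of the coordinate function in this Banach
algebra is not larger than `K`. -/
lemma exists_mem_closure_polynomialFunctions_inv_sub {K : Set ℂ} [CompactSpace K]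
    (hKc : IsPreconnected Kᶜ) {w : ℂ} (hw : w ∉ K) :
    ∃ g ∈ (polynomialFunctions K).topologicalClosure, ∀ z : K, g z = (w - z)⁻¹ := by
  let S := (polynomialFunctions K).topologicalClosure
  have hS : IsClosed (S : Set C(K, ℂ)) := Subalgebra.isClosed_topologicalClosure _
  let x : C(K, ℂ) := Polynomial.toContinuousMapOn Polynomial.X K
  have hx : x ∈ S := Subalgebra.le_topologicalClosure _ ⟨Polynomial.X, by simp, rfl⟩
  have hxz : ∀ z : K, x z = z := fun z => by simp [x]
  have hsp : spectrum ℂ x = K := by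
    rw [ContinuousMap.spectrum_eq_range]
    ext z
    constructor
    · rintro ⟨y, rfl⟩
      rw [hxz]; exact y.2
    · intro hz
      exact ⟨⟨z, hz⟩, hxz _⟩
  have h := Subalgebra.spectrum_eq_of_isPreconnected_compl (𝕜 := ℂ) S (⟨x, hx⟩ : S)
    (by rw [hsp]; exact hKc)
  have hw' : w ∉ spectrum ℂ (⟨x, hx⟩ : S) := by rw [h]; simpa [hsp] using hw
  rw [spectrum.notMem_iff] at hw'
  obtain ⟨u, hu⟩ := hw'
  refine ⟨((↑u⁻¹ : S) : C(K, ℂ)), (↑u⁻¹ : S).2, fun z => ?_⟩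
  have h1 : ((u : S) : C(K, ℂ)) * ((↑u⁻¹ : S) : C(K, ℂ)) = 1 := by
    exact congrArg (Subtype.val : S → C(K, ℂ)) u.mul_inv
  have h2 := congrArg (fun g : C(K, ℂ) => g z) h1
  have h3 : ((u : S) : C(K, ℂ)) z = w - z := by
    rw [hu]
    simp [hxz, algebraMap_apply]
  simp only [ContinuousMap.mul_apply, h3, ContinuousMap.one_apply] at h2
  exact eq_inv_of_mul_eq_one_right h2

lemma integral_mem_of_isClosed {E : Type*} [NormedAddCommGroup E] [NormedSpace ℂ E]
    [CompleteSpace E] {S : Submodule ℂ E} (hS : IsClosed (S : Set E)) {g : ℂ → E}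
    (hg : Continuous g) (hgs : HasCompactSupport g) (h : ∀ w, g w ∈ S) : ∫ w, g w ∈ S := by
  have : CompleteSpace S := hS.completeSpace_coe
  let g' : ℂ → S := fun w => ⟨g w, h w⟩
  have hc : Continuous g' := hg.subtype_mk h
  have hs : HasCompactSupport g' := hgs.mono fun w hw hw' => hw (Subtype.ext hw')
  have := S.subtypeL.integral_comp_comm (hc.integrable_of_hasCompactSupport hs (μ := volume))
  have h2 : ∫ w, g w = ∫ w, S.subtypeL (g' w) := rfl
  rw [h2, this]
  exact (∫ w, g' w).2

/-- A Cauchy transform of a density vanishing near `K` is a uniform limit of polynomials on `K`. -/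
lemma exists_polynomial_near_integral_div_sub {K : Set ℂ} (hK : IsCompact K)
    (hKc : IsPreconnected Kᶜ) {k : ℂ → ℂ} (hk : Continuous k) (hks : HasCompactSupport k)
    (hkK : ∀ z ∈ K, k =ᶠ[𝓝 z] 0) {ε : ℝ} (hε : 0 < ε) :
    ∃ p : Polynomial ℂ, ∀ z ∈ K, ‖(∫ w, k w / (w - z)) - p.eval z‖ < ε := by
  have : CompactSpace K := isCompact_iff_compactSpace.1 hK
  have hcont : Continuous fun q : ℂ × K => k q.1 / (q.1 - q.2) := by
    rw [continuous_iff_continuousAt]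
    rintro ⟨w, z⟩
    by_cases h : w = z
    · subst h
      have h0 : (fun q : ℂ × K => k q.1 / (q.1 - q.2)) =ᶠ[𝓝 ((z : ℂ), z)] fun _ => 0 := by
        filter_upwards [continuousAt_fst.eventually (hkK z z.2)] with q hq
        simp only [hq, Pi.zero_apply, zero_div]
      exact continuousAt_const.congr h0.symm
    · exact ContinuousAt.div (by fun_prop) (by fun_prop) (sub_ne_zero.2 h)
  -- view the integrand as a function of `w` with values in `C(K, ℂ)`
  let g : C(ℂ, C(K, ℂ)) := ContinuousMap.curry ⟨_, hcont⟩
  have hgz : ∀ w (z : K), g w z = k w / (w - z) := fun w z => rfl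
  have hgs : HasCompactSupport g := hks.mono fun w hw hw' => hw (by ext z; simp [hgz, hw'])
  let S := (polynomialFunctions K).topologicalClosure
  have hmem : ∀ w, g w ∈ Subalgebra.toSubmodule S := by
    intro w
    by_cases hw : w ∈ K
    · have : g w = 0 := by ext z; simp [hgz, (hkK w hw).self_of_nhds]
      rw [this]; exact zero_mem _
    · obtain ⟨r, hr, hrz⟩ := exists_mem_closure_polynomialFunctions_inv_sub hKc hw
      have : g w = k w • r := by ext z; simp [hgz, hrz, div_eq_mul_inv]
      rw [this]
      exact Submodule.smul_mem _ _ hr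
  have hint := integral_mem_of_isClosed (S := Subalgebra.toSubmodule S)
    (Subalgebra.isClosed_topologicalClosure _) g.continuous hgs hmem
  have hint' : (∫ w, g w) ∈ closure (polynomialFunctions K : Set C(K, ℂ)) := hint
  obtain ⟨q, hq, hqd⟩ := Metric.mem_closure_iff.1 hint' ε hε
  rw [polynomialFunctions_coe] at hq
  obtain ⟨p, rfl⟩ := hq
  refine ⟨p, fun z hz => ?_⟩
  have h1 : (∫ w, g w) ⟨z, hz⟩ = ∫ w, k w / (w - z) := by
    rw [ContinuousMap.integral_apply (g.continuous.integrable_of_hasCompactSupport hgs)]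
    rfl
  have h2 := (ContinuousMap.dist_apply_le_dist (⟨z, hz⟩ : K)).trans_lt hqd
  rw [h1, dist_eq_norm] at h2
  simpa using h2

/-- Runge's theorem for a compact set with connected complement. -/
theorem exists_polynomial_near {D K : Set ℂ} (hD : IsOpen D) {f : ℂ → ℂ}
    (hf : DifferentiableOn ℂ f D) (hK : IsCompact K) (hKD : K ⊆ D) (hKc : IsPreconnected Kᶜ)
    {ε : ℝ} (hε : 0 < ε) : ∃ p : Polynomial ℂ, ∀ z ∈ K, ‖f z - p.eval z‖ < ε := by
  obtain ⟨t, ht, hKt, htD⟩ := exists_compact_between hK hD hKD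
  obtain ⟨χ, hχ1, hχ0, -⟩ := exists_contMDiffMap_one_nhds_of_subset_interior
    (modelWithCornersSelf ℝ ℂ) (n := 1) hK.isClosed hKt
  have hχc : ContDiff ℝ 1 (χ : ℂ → ℝ) := χ.contMDiff.contDiff
  let F : ℂ → ℂ := fun w => (χ w : ℂ) * f w
  have hF0 : ∀ w ∉ t, F w = 0 := fun w hw => by simp [F, hχ0 w hw]
  have hFs : HasCompactSupport F := HasCompactSupport.intro ht hF0
  have hFc : ContDiff ℝ 1 F := by
    rw [contDiff_iff_contDiffAt]
    intro w
    by_cases hw : w ∈ D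
    · have h1 : ContDiffAt ℝ 1 f w :=
        ((hf.analyticAt (hD.mem_nhds hw)).contDiffAt (n := 1)).restrict_scalars ℝ
      exact (ofRealCLM.contDiff.contDiffAt.comp w hχc.contDiffAt).mul h1
    · have h0 : F =ᶠ[𝓝 w] fun _ => 0 := by
        filter_upwards [ht.isClosed.isOpen_compl.mem_nhds fun h => hw (htD h)] with v hv
        exact hF0 v hv
      exact contDiffAt_const.congr_of_eventuallyEq h0
  have hFf : ∀ z ∈ K, F =ᶠ[𝓝 z] f := by
    intro z hz
    filter_upwards [(eventually_nhdsSet_iff_forall.1 hχ1) z hz] with v hv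
    simp [F, hv]
  have hFd : ∀ z ∈ K, ∀ᶠ w in 𝓝 z, DifferentiableAt ℂ F w := by
    intro z hz
    filter_upwards [(hFf z hz).eventuallyEq_nhds, hD.mem_nhds (hKD hz)] with w hw hwD
    exact (hf.differentiableAt (hD.mem_nhds hwD)).congr_of_eventuallyEq hw
  have hpi : (0 : ℝ) < 2 * Real.pi := by positivity
  obtain ⟨p, hp⟩ := exists_polynomial_near_integral_div_sub hK hKc (continuous_dbar hFc)
    (hasCompactSupport_dbar hFs) (fun z hz => (hFd z hz).mono fun w hw => dbar_eq_zero hw)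
    (mul_pos hpi hε)
  refine ⟨Polynomial.C (-(2 * Real.pi * I))⁻¹ * p, fun z hz => ?_⟩
  have h := hp z hz
  have hc : (-(2 * Real.pi * I) : ℂ) ≠ 0 := neg_ne_zero.2 two_pi_I_ne_zero
  rw [integral_dbar_div_sub hFc hFs (hFd z hz), (hFf z hz).self_of_nhds] at h
  have h3 : -(2 * Real.pi * I) * f z - p.eval z =
      -(2 * Real.pi * I) * (f z - (-(2 * Real.pi * I))⁻¹ * p.eval z) := by
    rw [mul_sub, mul_inv_cancel_left₀ hc]
  rw [h3, norm_mul] at h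
  have h4 : ‖(-(2 * Real.pi * I) : ℂ)‖ = 2 * Real.pi := by
    simp [abs_of_pos Real.pi_pos]
  rw [h4] at h
  simpa using lt_of_mul_lt_mul_left h hpi.le

/-! ### Primitives and square roots -/

/-- Shrinking a set by `ε`: its complement is the open `ε`-neighbourhood of the complement. -/
lemma isPreconnected_compl_shrink {D : Set ℂ} (hDc : IsPreconnected Dᶜ) (ε : ℝ) :
    IsPreconnected {z | ∀ a ∈ Dᶜ, ε ≤ dist z a}ᶜ := by
  rcases le_or_gt ε 0 with hε | hε
  · have : {z | ∀ a ∈ Dᶜ, ε ≤ dist z a} = univ :=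
      eq_univ_of_forall fun z a _ => hε.trans dist_nonneg
    rw [this, compl_univ]
    exact isPreconnected_empty
  rcases Dᶜ.eq_empty_or_nonempty with h | ⟨b, hb⟩
  · simp [h, isPreconnected_empty]
  have hsub : Dᶜ ⊆ {z | ∀ a ∈ Dᶜ, ε ≤ dist z a}ᶜ := fun z hz h => by
    have := h z hz
    rw [dist_self] at this
    linarith
  refine isPreconnected_of_forall b fun z hz => ?_
  simp only [mem_compl_iff, mem_ofPred_eq, not_forall, not_le] at hz
  obtain ⟨a, ha, hza⟩ := hz
  refine ⟨ball a ε ∪ Dᶜ, union_subset (fun w hw => ?_) hsub, Or.inr hb, Or.inl hza,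
    (convex_ball a ε).isPreconnected.union a (mem_ball_self hε) ha hDc⟩
  intro h
  exact absurd (h a ha) (not_le.2 hw)

/-- On a bounded open set with connected complement, every holomorphic function is a locally uniform
limit of polynomials. -/
theorem exists_seq_polynomial_tendstoLocallyUniformlyOn {D : Set ℂ} (hD : IsOpen D)
    (hDb : Bornology.IsBounded D) (hDc : IsPreconnected Dᶜ) {f : ℂ → ℂ}
    (hf : DifferentiableOn ℂ f D) : ∃ p : ℕ → Polynomial ℂ,
      TendstoLocallyUniformlyOn (fun n z => (p n).eval z) f atTop D := by
  -- exhaust `D` by compact sets with connected complement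
  let K : ℕ → Set ℂ := fun n => {z | ∀ a ∈ Dᶜ, 1 / ((n : ℝ) + 1) ≤ dist z a}
  have hKD : ∀ n, K n ⊆ D := by
    intro n z hz
    by_contra h
    have := hz z h
    rw [dist_self] at this
    exact absurd this (not_le.2 (by positivity))
  have hKc : ∀ n, IsCompact (K n) := by
    intro n
    refine isCompact_of_isClosed_isBounded ?_ (hDb.subset (hKD n))
    simp only [K, ofPred_forall]
    exact isClosed_biInter fun a _ => isClosed_le continuous_const (by fun_prop)
  have hex : ∀ n : ℕ, ∃ p : Polynomial ℂ, ∀ z ∈ K n, ‖f z - p.eval z‖ < 1 / ((n : ℝ) + 1) :=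
    fun n => exists_polynomial_near hD hf (hKc n) (hKD n)
      (isPreconnected_compl_shrink hDc _) (by positivity)
  choose p hp using hex
  refine ⟨p, ?_⟩
  rw [Metric.tendstoLocallyUniformlyOn_iff]
  intro ε hε z hz
  obtain ⟨r, hr, hrD⟩ := Metric.isOpen_iff.1 hD z hz
  refine ⟨ball z (r / 2), mem_nhdsWithin_of_mem_nhds (ball_mem_nhds z (by positivity)), ?_⟩
  have h1 := tendsto_one_div_add_atTop_nhds_zero_nat (𝕜 := ℝ)
  filter_upwards [h1.eventually (gt_mem_nhds hε), h1.eventually (gt_mem_nhds (half_pos hr))]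
    with n hn1 hn2 w hw
  rw [dist_eq_norm]
  refine (hp n w fun a ha => ?_).trans hn1
  by_contra! h
  refine ha (hrD ?_)
  rw [mem_ball] at hw ⊢
  calc dist a z ≤ dist w a + dist w z := by rw [dist_comm w a]; exact dist_triangle _ _ _
    _ < r := by linarith

/-- Cauchy's theorem for a bounded domain with connected complement: holomorphic functions have
primitives. -/
theorem exists_primitive {D : Set ℂ} (hD : IsOpen D) (hDp : IsPreconnected D)
    (hDb : Bornology.IsBounded D) (hDc : IsPreconnected Dᶜ) {f : ℂ → ℂ}
    (hf : DifferentiableOn ℂ f D) : ∃ F : ℂ → ℂ, ∀ z ∈ D, HasDerivAt F (f z) z := by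
  rcases D.eq_empty_or_nonempty with rfl | ⟨a, ha⟩
  · exact ⟨0, by simp⟩
  obtain ⟨p, hp⟩ := exists_seq_polynomial_tendstoLocallyUniformlyOn hD hDb hDc hf
  have hex : ∀ n, ∃ P : ℂ → ℂ, P a = 0 ∧ ∀ z, HasDerivAt P ((p n).eval z) z := by
    intro n
    obtain ⟨P, hP⟩ := ((p n).differentiable.isExactOn_univ).with_val_at a 0
    exact ⟨P, hP.1, fun z => hP.2 z (mem_univ z)⟩
  choose P hPa hP using hex
  have hlu : ∀ z ∈ D, ∃ r > 0, TendstoUniformlyOn (fun n z => (p n).eval z) f atTop (ball z r) := by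
    intro z hz
    obtain ⟨r, hr, hrD⟩ := nhds_basis_closedBall.mem_iff.1 (hD.mem_nhds hz)
    exact ⟨r, hr, ((tendstoLocallyUniformlyOn_iff_forall_isCompact hD).1 hp _ hrD
      (isCompact_closedBall z r)).mono ball_subset_closedBall⟩
  -- the set where the primitives `P n` converge is open and closed in `D`, and contains `a`
  let t : Set ℂ := {z | z ∈ D ∧ CauchySeq fun n => P n z}
  have hball : ∀ z r, TendstoUniformlyOn (fun n z => (p n).eval z) f atTop (ball z r) →
      (CauchySeq fun n => P n z) → ∀ w ∈ ball z r, CauchySeq fun n => P n w := by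
    intro z r h hz w hw
    exact (uniformCauchySeqOn_ball_of_deriv h.uniformCauchySeqOn
      (fun n y _ => hP n y) hz).cauchy_map hw
  have htop : IsOpen t := by
    rw [isOpen_iff_mem_nhds]
    rintro z ⟨hz, hc⟩
    obtain ⟨r, hr, h⟩ := hlu z hz
    filter_upwards [ball_mem_nhds z hr, hD.mem_nhds hz] with w hw hwD
    exact ⟨hwD, hball z r h hc w hw⟩
  have hDt : D ⊆ t := by
    refine hDp.subset_of_closure_inter_subset htop ⟨a, ha, ha, ?_⟩ ?_
    · simpa only [hPa] using cauchySeq_const (0 : ℂ)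
    · rintro z ⟨hzc, hz⟩
      obtain ⟨r, hr, h⟩ := hlu z hz
      obtain ⟨y, hy, hyz⟩ := Metric.mem_closure_iff.1 hzc (r / 2) (half_pos hr)
      refine ⟨hz, hball y (r / 2) (h.mono (ball_subset_ball' ?_)) hy.2 z hyz⟩
      rw [dist_comm] at hyz
      linarith
  refine ⟨fun z => limUnder atTop fun n => P n z, fun z hz => ?_⟩
  exact hasDerivAt_of_tendstoLocallyUniformlyOn hD hp
    (Eventually.of_forall fun n x _ => hP n x) (fun x hx => (hDt hx).2.tendsto_limUnder) hz

/-- Nonvanishing holomorphic functions have square roots: a primitive of `f' / f` is, up to a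
constant, a logarithm of `f`. -/
theorem exists_sq_eq {D : Set ℂ} (hD : IsOpen D) (hDp : IsPreconnected D)
    (hDb : Bornology.IsBounded D) (hDc : IsPreconnected Dᶜ) {f : ℂ → ℂ}
    (hf : DifferentiableOn ℂ f D) (hf0 : ∀ z ∈ D, f z ≠ 0) :
    ∃ s : ℂ → ℂ, DifferentiableOn ℂ s D ∧ ∀ z ∈ D, s z ^ 2 = f z := by
  rcases D.eq_empty_or_nonempty with rfl | ⟨a, ha⟩
  · exact ⟨0, by simp⟩
  have hfd : ∀ z ∈ D, HasDerivAt f (deriv f z) z := fun z hz =>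
    (hf.differentiableAt (hD.mem_nhds hz)).hasDerivAt
  obtain ⟨l, hl⟩ := exists_primitive hD hDp hDb hDc ((hf.deriv hD).div hf hf0)
  -- `f * exp (-l)` has derivative zero
  have hg : ∀ z ∈ D, HasDerivAt (fun z => f z * exp (-l z)) 0 z := by
    intro z hz
    refine ((hfd z hz).mul (hl z hz).neg.cexp).congr_deriv ?_
    have := hf0 z hz
    simp only [Pi.div_apply]
    field_simp
    ring
  obtain ⟨c, hc⟩ := hD.exists_is_const_of_deriv_eq_zero hDp
    (fun z hz => (hg z hz).differentiableAt.differentiableWithinAt) (fun z hz => (hg z hz).deriv)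
  have hfc : ∀ z ∈ D, f z = c * exp (l z) := by
    intro z hz
    rw [← hc z hz, mul_assoc, ← Complex.exp_add]
    simp
  have hc0 : c ≠ 0 := fun h => hf0 a ha (by rw [hfc a ha, h, zero_mul])
  refine ⟨fun z => exp ((l z + log c) / 2), fun z hz =>
    (((hl z hz).differentiableAt.add_const _).div_const 2).cexp.differentiableWithinAt, ?_⟩
  intro z hz
  rw [hfc z hz, ← Complex.exp_nat_mul]
  push_cast
  rw [mul_div_cancel₀ _ two_ne_zero, Complex.exp_add, exp_log hc0, mul_comm]

/-! ### Theorems of Hurwitz and Montel -/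

/-- Hurwitz's theorem: a zero of a locally uniform limit, at which the limit does not vanish
identically, is approximated by zeros; here only their existence in `U` is recorded. The image of a
small disc about the zero contains a disc of fixed radius about `F i z`, which contains `0`. -/
theorem eventually_exists_zero_of_tendstoLocallyUniformlyOn {ι : Type*} {l : Filter ι} [l.NeBot]
    {F : ι → ℂ → ℂ} {f : ℂ → ℂ} {U : Set ℂ} (hU : IsOpen U)
    (hF : TendstoLocallyUniformlyOn F f l U) (hd : ∀ i, DifferentiableOn ℂ (F i) U) {z : ℂ}
    (hz : z ∈ U) (h0 : f z = 0) (hne : ¬ ∀ᶠ w in 𝓝 z, f w = 0) :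
    ∀ᶠ i in l, ∃ w ∈ U, F i w = 0 := by
  have hfd : DifferentiableOn ℂ f U := hF.differentiableOn (Eventually.of_forall hd) hU
  have hev :=
    (hfd.analyticAt (hU.mem_nhds hz)).eventually_eq_zero_or_eventually_ne_zero.resolve_left hne
  rw [eventually_nhdsWithin_iff] at hev
  obtain ⟨r, hr, hrU⟩ := nhds_basis_closedBall.mem_iff.1 (inter_mem hev (hU.mem_nhds hz))
  have hrU' : closedBall z r ⊆ U := fun w hw => (hrU hw).2
  have hsph : ∀ w ∈ sphere z r, f w ≠ 0 := fun w hw =>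
    (hrU (sphere_subset_closedBall hw)).1 (ne_of_mem_sphere hw hr.ne')
  obtain ⟨m, hm, hmin⟩ := (isCompact_sphere z r).exists_isMinOn
    (NormedSpace.sphere_nonempty.2 hr.le)
    ((hfd.continuousOn.mono (sphere_subset_closedBall.trans hrU')).norm)
  set ε := ‖f m‖ with hε
  have hε0 : 0 < ε := norm_pos_iff.2 (hsph m hm)
  have hunif := (tendstoLocallyUniformlyOn_iff_forall_isCompact hU).1 hF _ hrU'
    (isCompact_closedBall z r)
  filter_upwards [Metric.tendstoUniformlyOn_iff.1 hunif (ε / 4) (by positivity)] with i hi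
  have hiz := hi z (mem_closedBall_self hr.le)
  rw [h0, dist_zero_left] at hiz
  have hlow : ∀ w ∈ sphere z r, ε / 2 ≤ ‖F i w - F i z‖ := by
    intro w hw
    have h1 : ε ≤ ‖f w‖ := hmin hw
    have h2 := hi w (sphere_subset_closedBall hw)
    rw [dist_eq_norm] at h2
    have h3 : ‖f w‖ ≤ ‖f w - F i w‖ + ‖F i w - F i z‖ + ‖F i z‖ := by
      calc ‖f w‖ = ‖(f w - F i w) + (F i w - F i z) + F i z‖ := by ring_nf
        _ ≤ _ := norm_add₃_le
    linarith
  have hfreq : ∃ᶠ w in 𝓝 z, F i w ≠ F i z := by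
    intro hcon
    simp only [not_not] at hcon
    have han : AnalyticOnNhd ℂ (F i) (closedBall z r) := ((hd i).analyticOnNhd hU).mono hrU'
    have := han.eqOn_of_preconnected_of_eventuallyEq analyticOnNhd_const
      (convex_closedBall z r).isPreconnected (mem_closedBall_self hr.le) hcon
    have h4 := hlow m hm
    rw [this (sphere_subset_closedBall hm), sub_self, norm_zero] at h4
    linarith
  have hdc : DiffContOnCl ℂ (F i) (ball z r) :=
    ((hd i).mono (closure_ball_subset_closedBall.trans hrU')).diffContOnCl
  obtain ⟨w, hw, hw0⟩ := hdc.ball_subset_image_closedBall hr hlow hfreq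
    (show (0 : ℂ) ∈ ball (F i z) (ε / 2 / 2) by
      rw [mem_ball, dist_zero_left]; linarith)
  exact ⟨w, hrU' hw, hw0⟩

/-- Montel's theorem: functions bounded by `1` converge locally uniformly along any ultrafilter. -/
theorem exists_tendstoLocallyUniformlyOn_ultrafilter {ι : Type*} (l : Ultrafilter ι)
    {F : ι → ℂ → ℂ} {U : Set ℂ} (hU : IsOpen U) (hd : ∀ i, DifferentiableOn ℂ (F i) U)
    (hb : ∀ i, MapsTo (F i) U (ball 0 1)) :
    ∃ f : ℂ → ℂ, TendstoLocallyUniformlyOn F f l U ∧ MapsTo f U (closedBall 0 1) := by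
  have hlim : ∀ z, ∃ y, z ∈ U → y ∈ closedBall (0 : ℂ) 1 ∧ Tendsto (fun i => F i z) l (𝓝 y) := by
    intro z
    by_cases hz : z ∈ U
    · obtain ⟨y, hy, hly⟩ := (isCompact_closedBall (0 : ℂ) 1).ultrafilter_le_nhds'
        (l.map fun i => F i z)
        (Ultrafilter.mem_map.2 (Filter.univ_mem' fun i => ball_subset_closedBall (hb i hz)))
      exact ⟨y, fun _ => ⟨hy, hly⟩⟩
    · exact ⟨0, fun h => absurd h hz⟩
  choose f hf using hlim
  refine ⟨f, ?_, fun z hz => (hf z hz).1⟩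
  rw [Metric.tendstoLocallyUniformlyOn_iff]
  intro ε hε z hz
  obtain ⟨r, hr, hrU⟩ := Metric.isOpen_iff.1 hU z hz
  set δ := min r (r / 2 * (ε / 4)) with hδ
  have hδ0 : 0 < δ := by positivity
  -- by the Schwarz lemma the family is Lipschitz at `z`, uniformly in the index
  have hosc : ∀ i, ∀ w ∈ ball z δ, dist (F i w) (F i z) ≤ ε / 4 := by
    intro i w hw
    have hwr : w ∈ ball z r := ball_subset_ball (min_le_left _ _) hw
    have h1 : MapsTo (F i) (ball z r) (closedBall (F i z) 2) := by
      intro v hv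
      have h2 := hb i (hrU hv)
      have h3 := hb i hz
      rw [mem_ball] at h2 h3
      rw [mem_closedBall]
      calc dist (F i v) (F i z) ≤ dist (F i v) 0 + dist (F i z) 0 := dist_triangle_right _ _ _
        _ ≤ 2 := by linarith
    have h4 := dist_le_div_mul_dist_of_mapsTo_ball ((hd i).mono hrU) h1 hwr
    refine h4.trans ?_
    have h5 : dist w z ≤ r / 2 * (ε / 4) := (mem_ball.1 hw).le.trans (min_le_right _ _)
    calc 2 / r * dist w z ≤ 2 / r * (r / 2 * (ε / 4)) := by gcongr
      _ = ε / 4 := by field_simp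
  refine ⟨ball z δ, mem_nhdsWithin_of_mem_nhds (ball_mem_nhds z hδ0), ?_⟩
  have hz1 := (hf z hz).2
  filter_upwards [hz1 (ball_mem_nhds _ (show 0 < ε / 4 by positivity))] with i hi w hw
  have hwU : w ∈ U := hrU (ball_subset_ball (min_le_left _ _) hw)
  have h1 : dist (f w) (f z) ≤ ε / 4 :=
    le_of_tendsto ((hf w hwU).2.dist hz1) (Eventually.of_forall fun j => hosc j w hw)
  have h2 := hosc i w hw
  have h3 : dist (F i z) (f z) < ε / 4 := hi
  calc dist (f w) (F i w) ≤ dist (f w) (f z) + dist (f z) (F i z) + dist (F i z) (F i w) :=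
        dist_triangle4 _ _ _ _
    _ < ε := by rw [dist_comm (f z), dist_comm (F i z) (F i w)]; linarith

/-! ### Automorphisms of the disc -/

/-- The disc automorphism sending `w` to `0`. -/
noncomputable def mobius (w z : ℂ) : ℂ := (z - w) / (1 - conj w * z)

lemma one_sub_conj_mul_ne_zero {w z : ℂ} (hw : ‖w‖ < 1) (hz : ‖z‖ ≤ 1) : 1 - conj w * z ≠ 0 := by
  intro h
  have h1 : ‖conj w * z‖ = 1 := by rw [← sub_eq_zero.1 h, norm_one]
  rw [norm_mul, RCLike.norm_conj] at h1
  nlinarith [norm_nonneg w, norm_nonneg z]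

lemma norm_one_sub_conj_mul_sq_sub (w z : ℂ) :
    ‖1 - conj w * z‖ ^ 2 - ‖z - w‖ ^ 2 = (1 - ‖w‖ ^ 2) * (1 - ‖z‖ ^ 2) := by
  simp only [← normSq_eq_norm_sq, normSq_apply]
  simp
  ring

lemma norm_mobius_lt_one {w z : ℂ} (hw : ‖w‖ < 1) (hz : ‖z‖ < 1) : ‖mobius w z‖ < 1 := by
  have h0 := norm_pos_iff.2 (one_sub_conj_mul_ne_zero hw hz.le)
  rw [mobius, norm_div, div_lt_one h0]
  have h1 := norm_one_sub_conj_mul_sq_sub w z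
  have h2 : 0 < (1 - ‖w‖ ^ 2) * (1 - ‖z‖ ^ 2) := by
    apply mul_pos <;> nlinarith [norm_nonneg w, norm_nonneg z]
  exact lt_of_pow_lt_pow_left₀ 2 h0.le (by linarith)

lemma hasDerivAt_mobius {w z : ℂ} (h : 1 - conj w * z ≠ 0) :
    HasDerivAt (mobius w) ((1 - ‖w‖ ^ 2) / (1 - conj w * z) ^ 2) z := by
  have h1 := ((hasDerivAt_id z).sub_const w).div
    (((hasDerivAt_id z).const_mul (conj w)).const_sub 1) h
  refine h1.congr_deriv ?_
  have h2 : (‖w‖ : ℂ) ^ 2 = conj w * w := by rw [← conj_mul']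
  rw [h2]
  simp only [id]
  congr 1
  ring

lemma mobius_injective {w x y : ℂ} (hw : ‖w‖ < 1) (hx : ‖x‖ < 1) (hy : ‖y‖ < 1)
    (h : mobius w x = mobius w y) : x = y := by
  rw [mobius, mobius, div_eq_div_iff (one_sub_conj_mul_ne_zero hw hx.le)
    (one_sub_conj_mul_ne_zero hw hy.le)] at h
  have h1 : (1 - conj w * w) * (x - y) = 0 := by linear_combination h
  exact sub_eq_zero.1 ((mul_eq_zero.1 h1).resolve_left (one_sub_conj_mul_ne_zero hw hw.le))

lemma one_sub_norm_sq_ne_zero {w : ℂ} (hw : ‖w‖ < 1) : (1 - (‖w‖ : ℂ) ^ 2) ≠ 0 := by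
  rw [← conj_mul']
  exact one_sub_conj_mul_ne_zero hw hw.le

/-! ### The Riemann mapping theorem -/

/-- `g` is a conformal embedding of `D` into the unit disc which sends `a` to `0`. -/
structure IsDiscEmbedding (D : Set ℂ) (a : ℂ) (g : ℂ → ℂ) : Prop where
  differentiableOn : DifferentiableOn ℂ g D
  injOn : InjOn g D
  mapsTo : MapsTo g D (ball 0 1)
  apply_eq_zero : g a = 0
  deriv_ne_zero : ∀ z ∈ D, deriv g z ≠ 0

/-- Koebe's step: an embedding which omits a point of the disc is not extremal. -/
lemma IsDiscEmbedding.exists_norm_deriv_lt {D : Set ℂ} (hD : IsOpen D) {a : ℂ} (ha : a ∈ D)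
    (hsq : ∀ f : ℂ → ℂ, DifferentiableOn ℂ f D → (∀ z ∈ D, f z ≠ 0) →
      ∃ s : ℂ → ℂ, DifferentiableOn ℂ s D ∧ ∀ z ∈ D, s z ^ 2 = f z)
    {g : ℂ → ℂ} (hg : IsDiscEmbedding D a g) {w : ℂ} (hw : w ∈ ball (0 : ℂ) 1)
    (hwg : w ∉ g '' D) : ∃ h, IsDiscEmbedding D a h ∧ ‖deriv g a‖ < ‖deriv h a‖ := by
  rw [mem_ball_zero_iff] at hw
  have hg1 : ∀ z ∈ D, ‖g z‖ < 1 := fun z hz => mem_ball_zero_iff.1 (hg.mapsTo hz)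
  have hgd : ∀ z ∈ D, HasDerivAt g (deriv g z) z := fun z hz =>
    (hg.differentiableOn.differentiableAt (hD.mem_nhds hz)).hasDerivAt
  have hmd : ∀ z ∈ D, HasDerivAt (fun z => mobius w (g z))
      ((1 - ‖w‖ ^ 2) / (1 - conj w * g z) ^ 2 * deriv g z) z := fun z hz =>
    (hasDerivAt_mobius (one_sub_conj_mul_ne_zero hw (hg1 z hz).le)).comp z (hgd z hz)
  -- move the omitted value `w` to `0`, take a square root, and move the value at `a` back to `0`
  obtain ⟨s, hs, hs2⟩ := hsq (fun z => mobius w (g z))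
    (fun z hz => (hmd z hz).differentiableAt.differentiableWithinAt) (by
      intro z hz h
      rw [mobius, div_eq_zero_iff] at h
      exact hwg ⟨z, hz, sub_eq_zero.1
        (h.resolve_right (one_sub_conj_mul_ne_zero hw (hg1 z hz).le))⟩)
  have hs1 : ∀ z ∈ D, ‖s z‖ < 1 := by
    intro z hz
    have h1 : ‖s z‖ ^ 2 < 1 := by
      rw [← norm_pow, hs2 z hz]
      exact norm_mobius_lt_one hw (hg1 z hz)
    exact (sq_lt_one_iff₀ (norm_nonneg _)).1 h1
  have hsd : ∀ z ∈ D, HasDerivAt s (deriv s z) z := fun z hz =>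
    (hs.differentiableAt (hD.mem_nhds hz)).hasDerivAt
  have hss : ∀ z ∈ D, 2 * s z * deriv s z =
      (1 - ‖w‖ ^ 2) / (1 - conj w * g z) ^ 2 * deriv g z := by
    intro z hz
    have h1 := (hsd z hz).pow 2
    have h2 : (fun z => mobius w (g z)) =ᶠ[𝓝 z] s ^ 2 := by
      filter_upwards [hD.mem_nhds hz] with v hv
      rw [Pi.pow_apply, hs2 v hv]
    have h3 := (h1.congr_of_eventuallyEq h2).unique (hmd z hz)
    simpa using h3
  have hs' : ∀ z ∈ D, deriv s z ≠ 0 := by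
    intro z hz h
    have h1 := hss z hz
    rw [h, mul_zero] at h1
    exact mul_ne_zero (div_ne_zero (one_sub_norm_sq_ne_zero hw)
      (pow_ne_zero 2 (one_sub_conj_mul_ne_zero hw (hg1 z hz).le))) (hg.deriv_ne_zero z hz) h1.symm
  set b := s a with hb
  have hb1 : ‖b‖ < 1 := hs1 a ha
  have hhd : ∀ z ∈ D, HasDerivAt (fun z => mobius b (s z))
      ((1 - ‖b‖ ^ 2) / (1 - conj b * s z) ^ 2 * deriv s z) z := fun z hz =>
    (hasDerivAt_mobius (one_sub_conj_mul_ne_zero hb1 (hs1 z hz).le)).comp z (hsd z hz)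
  refine ⟨fun z => mobius b (s z), ⟨fun z hz => (hhd z hz).differentiableAt.differentiableWithinAt,
    ?_, fun z hz => mem_ball_zero_iff.2 (norm_mobius_lt_one hb1 (hs1 z hz)), ?_, ?_⟩, ?_⟩
  · intro x hx y hy hxy
    have h1 := mobius_injective hb1 (hs1 x hx) (hs1 y hy) hxy
    have h2 : mobius w (g x) = mobius w (g y) := by rw [← hs2 x hx, ← hs2 y hy, h1]
    exact hg.injOn hx hy (mobius_injective hw (hg1 x hx) (hg1 y hy) h2)
  · simp [mobius, hb]
  · intro z hz
    rw [(hhd z hz).deriv]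
    exact mul_ne_zero (div_ne_zero (one_sub_norm_sq_ne_zero hb1)
      (pow_ne_zero 2 (one_sub_conj_mul_ne_zero hb1 (hs1 z hz).le))) (hs' z hz)
  · have hbw : ‖b‖ ^ 2 = ‖w‖ := by
      rw [← norm_pow, hs2 a ha, hg.apply_eq_zero]
      simp [mobius]
    have hw0 : 0 < ‖w‖ := by
      rw [norm_pos_iff]
      rintro rfl
      exact hwg ⟨a, ha, hg.apply_eq_zero⟩
    have hb0 : 0 < ‖b‖ := by
      rcases (norm_nonneg b).eq_or_lt with h | h
      · rw [← h] at hbw; norm_num at hbw; linarith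
      · exact h
    have h1 : 2 * ‖b‖ * ‖deriv s a‖ = (1 - ‖w‖ ^ 2) * ‖deriv g a‖ := by
      have h2 := congrArg norm (hss a ha)
      rw [hg.apply_eq_zero] at h2
      have h3 : ‖(1 - (‖w‖ : ℂ) ^ 2)‖ = 1 - ‖w‖ ^ 2 := by
        have : (1 - (‖w‖ : ℂ) ^ 2) = ((1 - ‖w‖ ^ 2 : ℝ) : ℂ) := by push_cast; rfl
        rw [this, norm_real, Real.norm_of_nonneg]
        nlinarith
      simpa [h3] using h2
    have h4 : ‖deriv (fun z => mobius b (s z)) a‖ = ‖deriv s a‖ / (1 - ‖b‖ ^ 2) := by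
      rw [(hhd a ha).deriv, ← hb, conj_mul', sq (1 - (‖b‖ : ℂ) ^ 2), div_mul_eq_div_div,
        div_self (one_sub_norm_sq_ne_zero hb1), norm_mul, norm_div, norm_one]
      have : (1 - (‖b‖ : ℂ) ^ 2) = ((1 - ‖b‖ ^ 2 : ℝ) : ℂ) := by push_cast; rfl
      rw [this, norm_real, Real.norm_of_nonneg]
      · ring
      · nlinarith
    have hg0 : 0 < ‖deriv g a‖ := norm_pos_iff.2 (hg.deriv_ne_zero a ha)
    have hb2 : 0 < 1 - ‖b‖ ^ 2 := by nlinarith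
    rw [h4, lt_div_iff₀ hb2]
    rw [← hbw] at h1
    -- the inequality amounts to `2 t < 1 + t ^ 2` for `t = ‖b‖`
    have h5 : 2 * ‖b‖ * ‖deriv s a‖ = (1 - ‖b‖ ^ 2) * (1 + ‖b‖ ^ 2) * ‖deriv g a‖ := by
      rw [h1]; ring
    have h6 : 2 * ‖b‖ * (‖deriv g a‖ * (1 - ‖b‖ ^ 2)) < 2 * ‖b‖ * ‖deriv s a‖ := by
      rw [h5]
      have h7 : 0 < (1 - ‖b‖) ^ 2 := by
        have : 0 < 1 - ‖b‖ := by linarith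
        positivity
      nlinarith [mul_pos (mul_pos hg0 hb2) h7]
    exact lt_of_mul_lt_mul_left h6 (by positivity)

/-- The Riemann mapping theorem for a bounded domain on which nonvanishing holomorphic functions
have square roots. -/
theorem exists_isDiscEmbedding_bijOn {D : Set ℂ} (hD : IsOpen D) (hDp : IsPreconnected D)
    (hDb : Bornology.IsBounded D) {a : ℂ} (ha : a ∈ D)
    (hsq : ∀ f : ℂ → ℂ, DifferentiableOn ℂ f D → (∀ z ∈ D, f z ≠ 0) →
      ∃ s : ℂ → ℂ, DifferentiableOn ℂ s D ∧ ∀ z ∈ D, s z ^ 2 = f z) :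
    ∃ g, IsDiscEmbedding D a g ∧ SurjOn g D (ball 0 1) := by
  -- maximize `‖g' a‖`; a maximizer cannot omit a value, by Koebe's step
  let S : Set ℝ := {x | ∃ g, IsDiscEmbedding D a g ∧ ‖deriv g a‖ = x}
  have hSb : BddAbove S := by
    obtain ⟨r, hr, hrD⟩ := nhds_basis_closedBall.mem_iff.1 (hD.mem_nhds ha)
    refine ⟨1 / r, ?_⟩
    rintro _ ⟨g, hg, rfl⟩
    refine norm_deriv_le_of_forall_mem_sphere_norm_le hr
      ((hg.differentiableOn.mono (closure_ball_subset_closedBall.trans hrD)).diffContOnCl) ?_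
    intro z hz
    exact (mem_ball_zero_iff.1 (hg.mapsTo (hrD (sphere_subset_closedBall hz)))).le
  have hSn : ∃ x ∈ S, 0 < x := by
    obtain ⟨R, hR0, hR⟩ := hDb.subset_ball_lt 0 a
    have hd : ∀ z, HasDerivAt (fun z : ℂ => (z - a) / R) (1 / R) z := fun z =>
      ((hasDerivAt_id z).sub_const a).div_const _
    have hRc : (R : ℂ) ≠ 0 := ofReal_ne_zero.2 hR0.ne'
    refine ⟨_, ⟨fun z => (z - a) / R, ⟨fun z _ => (hd z).differentiableAt.differentiableWithinAt,
      ?_, ?_, by simp, ?_⟩, rfl⟩, ?_⟩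
    · intro x _ y _ hxy
      simpa [div_left_inj' hRc] using hxy
    · intro z hz
      rw [mem_ball_zero_iff, norm_div, norm_real, Real.norm_of_nonneg hR0.le, div_lt_one hR0]
      simpa [dist_eq_norm] using hR hz
    · intro z _
      rw [(hd z).deriv]
      exact one_div_ne_zero hRc
    · rw [(hd a).deriv]
      exact norm_pos_iff.2 (one_div_ne_zero hRc)
  obtain ⟨x₀, hx₀, hx₀pos⟩ := hSn
  obtain ⟨u, -, hu, huS⟩ := exists_seq_tendsto_sSup ⟨x₀, hx₀⟩ hSb
  choose F hF hFu using huS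
  obtain ⟨g, hg, hgb⟩ := exists_tendstoLocallyUniformlyOn_ultrafilter (hyperfilter ℕ) hD
    (fun n => (hF n).differentiableOn) (fun n => (hF n).mapsTo)
  have hle : ((hyperfilter ℕ : Ultrafilter ℕ) : Filter ℕ) ≤ atTop := Nat.hyperfilter_le_atTop
  have hFd : ∀ᶠ n in (hyperfilter ℕ : Filter ℕ), DifferentiableOn ℂ (F n) D :=
    Eventually.of_forall fun n => (hF n).differentiableOn
  have hgd : DifferentiableOn ℂ g D := hg.differentiableOn hFd hD
  have hg' := hg.deriv hFd hD
  have hM : ‖deriv g a‖ = sSup S := by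
    refine tendsto_nhds_unique (hg'.tendsto_at ha).norm ?_
    simpa only [Function.comp_apply, hFu] using hu.mono_left hle
  have hga' : deriv g a ≠ 0 := by
    rw [← norm_pos_iff, hM]
    exact hx₀pos.trans_le (le_csSup hSb hx₀)
  have hga : g a = 0 := by
    refine tendsto_nhds_unique (hg.tendsto_at ha) ?_
    simp only [(hF _).apply_eq_zero, tendsto_const_nhds_iff]
  have hgan : AnalyticOnNhd ℂ g D := hgd.analyticOnNhd hD
  have hnc : ∀ z ∈ D, ∀ c, ¬ ∀ᶠ w in 𝓝 z, g w = c := by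
    intro z hz c h
    have h1 := hgan.eqOn_of_preconnected_of_eventuallyEq analyticOnNhd_const hDp hz h
    apply hga'
    have h2 : g =ᶠ[𝓝 a] fun _ => c := by
      filter_upwards [hD.mem_nhds ha] with w hw using h1 hw
    rw [h2.deriv_eq, deriv_const]
  have hge : IsDiscEmbedding D a g := by
    refine ⟨hgd, ?_, ?_, hga, ?_⟩
    · intro x hx y hy hxy
      by_contra hne
      -- `F n - F n x` has no zero in `D \ {x}`, so its limit has none unless it is constant
      have hUo : IsOpen (D \ {x}) := hD.sdiff isClosed_singleton
      have hlim : TendstoLocallyUniformlyOn (fun n z => F n z - F n x) (fun z => g z - g x)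
          (hyperfilter ℕ : Filter ℕ) (D \ {x}) := by
        refine (hg.mono sdiff_subset).fun_sub ?_
        exact (((hg.tendsto_at hx).tendstoUniformlyOn_const _)).tendstoLocallyUniformlyOn
      have hH := eventually_exists_zero_of_tendstoLocallyUniformlyOn hUo hlim
        (fun n => ((hF n).differentiableOn.mono sdiff_subset).sub_const _) (z := y)
        ⟨hy, fun h => hne h.symm⟩ (sub_eq_zero.2 hxy.symm)
        (fun h => hnc y hy (g x) (h.mono fun w hw => sub_eq_zero.1 hw))
      obtain ⟨n, w, hw, hw0⟩ := hH.exists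
      exact hw.2 ((hF n).injOn hw.1 hx (sub_eq_zero.1 hw0))
    · intro z hz
      rcases (mem_closedBall_zero_iff.1 (hgb hz)).lt_or_eq with h | h
      · exact mem_ball_zero_iff.2 h
      · exfalso
        have hmax : IsMaxOn (norm ∘ g) D z := fun w hw => by
          simpa [h] using hgb hw
        have := eqOn_of_isPreconnected_of_isMaxOn_norm hDp hD hgd hz hmax ha
        rw [hga, Function.const_apply] at this
        rw [← this, norm_zero] at h
        exact zero_ne_one h
    · intro z hz h0
      have hne : ¬ ∀ᶠ w in 𝓝 z, deriv g w = 0 := by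
        intro h
        exact hga'
          ((hgan.deriv.eqOn_of_preconnected_of_eventuallyEq analyticOnNhd_const hDp hz h) ha)
      obtain ⟨n, w, hw, hw0⟩ := (eventually_exists_zero_of_tendstoLocallyUniformlyOn hD hg'
        (fun n => (hF n).differentiableOn.deriv hD) hz h0 hne).exists
      exact (hF n).deriv_ne_zero w hw hw0
  refine ⟨g, hge, fun w hw => ?_⟩
  by_contra hwg
  obtain ⟨h, hh, hlt⟩ := hge.exists_norm_deriv_lt hD ha hsq hw hwg
  exact absurd (le_csSup hSb ⟨h, hh, rfl⟩) (not_le.2 (hM ▸ hlt))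

/-! ### Zeros and factorizations -/

lemma analyticAt_prod_sub (s : Multiset ℂ) (z : ℂ) :
    AnalyticAt ℂ (fun w => (s.map fun r => w - r).prod) z := by
  induction s using Multiset.induction_on with
  | empty => simpa using analyticAt_const
  | cons r s ih =>
    simp only [Multiset.map_cons, Multiset.prod_cons]
    exact (analyticAt_id.sub analyticAt_const).mul ih

lemma analyticOrderAt_prod_sub (s : Multiset ℂ) (z : ℂ) :
    analyticOrderAt (fun w => (s.map fun r => w - r).prod) z = s.count z := by
  induction s using Multiset.induction_on with
  | empty =>
    simp [analyticOrderAt_eq_zero]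
  | cons r s ih =>
    have h1 : (fun w => ((r ::ₘ s).map fun r => w - r).prod) =
        (fun w => w - r) * fun w => (s.map fun r => w - r).prod := by
      ext w; simp
    have hr : AnalyticAt ℂ (fun w => w - r) z := analyticAt_id.sub analyticAt_const
    rw [h1, analyticOrderAt_mul hr (analyticAt_prod_sub s z), ih, Multiset.count_cons]
    by_cases h : z = r
    · subst h
      have : analyticOrderAt (fun w : ℂ => w - z) z = (1 : ℕ) := by
        rw [hr.analyticOrderAt_eq_natCast]
        exact ⟨fun _ => 1, analyticAt_const, one_ne_zero, by simp⟩
      rw [this, if_pos rfl]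
      push_cast
      rw [add_comm]
    · have : analyticOrderAt (fun w : ℂ => w - r) z = 0 := by
        rw [hr.analyticOrderAt_eq_zero]
        exact sub_ne_zero.2 h
      rw [this, if_neg h]
      simp

/-- The zeros of a function can be read off from a factorization. -/
lemma zeroSet_zeroCount_of_factorization {U : Set ℂ} (hU : IsOpen U) {F u : ℂ → ℂ}
    {s : Multiset ℂ} (hs : ∀ r ∈ s, r ∈ U) (hu : AnalyticOnNhd ℂ u U) (hu0 : ∀ z ∈ U, u z ≠ 0)
    (hF : ∀ z ∈ U, F z = (s.map fun r => z - r).prod * u z) :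
    zeroSet F U = {z | z ∈ s} ∧ zeroCount F U = s.card := by
  have hset : zeroSet F U = {z | z ∈ s} := by
    ext z
    simp only [zeroSet, mem_ofPred_eq]
    constructor
    · rintro ⟨hz, h⟩
      rw [hF z hz, mul_eq_zero, or_iff_left (hu0 z hz), Multiset.prod_eq_zero_iff,
        Multiset.mem_map] at h
      obtain ⟨r, hr, h⟩ := h
      rwa [sub_eq_zero.1 h]
    · intro h
      refine ⟨hs z h, ?_⟩
      rw [hF z (hs z h), Multiset.prod_eq_zero (Multiset.mem_map.2 ⟨z, h, sub_self z⟩), zero_mul]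
  refine ⟨hset, ?_⟩
  have hord : ∀ z ∈ U, analyticOrderNatAt F z = s.count z := by
    intro z hz
    have h1 : F =ᶠ[𝓝 z] (fun w => (s.map fun r => w - r).prod) * u := by
      filter_upwards [hU.mem_nhds hz] with w hw using hF w hw
    rw [analyticOrderNatAt, analyticOrderAt_congr h1,
      analyticOrderAt_mul (analyticAt_prod_sub s z) (hu z hz), analyticOrderAt_prod_sub,
      (hu z hz).analyticOrderAt_eq_zero.2 (hu0 z hz)]
    simp
  rw [zeroCount, hset]
  have h2 : {z | z ∈ s} = (s.toFinset : Set ℂ) := by ext; simp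
  rw [h2, finsum_mem_coe_finset, ← Multiset.toFinset_sum_count_eq s]
  exact Finset.sum_congr rfl fun z hz => hord z (hs z (Multiset.mem_toFinset.1 hz))

/-- An analytic function with finitely many zeros is a product of linear factors and a nonvanishing
analytic function. -/
lemma exists_factorization {U : Set ℂ} (T : Finset ℂ) : ∀ {F : ℂ → ℂ},
    AnalyticOnNhd ℂ F U → (∀ z ∈ U, analyticOrderAt F z ≠ ⊤) → zeroSet F U ⊆ T →
    ∃ (s : Multiset ℂ) (u : ℂ → ℂ), (∀ r ∈ s, r ∈ U) ∧ AnalyticOnNhd ℂ u U ∧ (∀ z ∈ U, u z ≠ 0) ∧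
      ∀ z ∈ U, F z = (s.map fun r => z - r).prod * u z := by
  induction T using Finset.induction_on with
  | empty =>
    intro F hF _ hT
    refine ⟨0, F, by simp, hF, fun z hz h => ?_, by simp⟩
    simpa using hT ⟨hz, h⟩
  | insert r T _ ih =>
    intro F hF htop hT
    by_cases hr : r ∈ U
    swap
    · refine ih hF htop fun z hz => ?_
      have := hT hz
      rw [Finset.coe_insert] at this
      exact this.resolve_left fun h => hr (h ▸ hz.1)
    obtain ⟨g, hg, hg0, hFg⟩ := (hF r hr).analyticOrderAt_ne_top.1 (htop r hr)
    set n := analyticOrderNatAt F r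
    let G : ℂ → ℂ := fun z => if z = r then g r else F z / (z - r) ^ n
    have hGne : ∀ z, z ≠ r → G =ᶠ[𝓝 z] fun w => F w / (w - r) ^ n := by
      intro z hz
      filter_upwards [isOpen_ne.mem_nhds hz] with w hw
      exact if_neg hw
    have hGr : G =ᶠ[𝓝 r] g := by
      filter_upwards [hFg] with w hw
      by_cases h : w = r
      · simp [G, h]
      · have : (w - r) ^ n ≠ 0 := pow_ne_zero _ (sub_ne_zero.2 h)
        simp only [G, if_neg h, hw, smul_eq_mul]
        field_simp
    have hGa : AnalyticOnNhd ℂ G U := by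
      intro z hz
      by_cases h : z = r
      · subst h
        exact hg.congr hGr.symm
      · refine AnalyticAt.congr ?_ (hGne z h).symm
        exact (hF z hz).div ((analyticAt_id.sub analyticAt_const).pow n)
          (pow_ne_zero _ (sub_ne_zero.2 h))
    have hFG : ∀ z ∈ U, F z = (z - r) ^ n * G z := by
      intro z hz
      by_cases h : z = r
      · subst h
        have h1 := hFg.self_of_nhds
        have h2 := hGr.self_of_nhds
        simp only [smul_eq_mul] at h1
        rw [h1, h2]
      · have : (z - r) ^ n ≠ 0 := pow_ne_zero _ (sub_ne_zero.2 h)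
        simp only [G, if_neg h]
        field_simp
    have hGtop : ∀ z ∈ U, analyticOrderAt G z ≠ ⊤ := by
      intro z hz h
      by_cases hzr : z = r
      · subst hzr
        rw [analyticOrderAt_congr hGr, hg.analyticOrderAt_eq_zero.2 hg0] at h
        simp at h
      · apply htop z hz
        rw [analyticOrderAt_eq_top] at h ⊢
        filter_upwards [h, hGne z hzr, isOpen_ne.mem_nhds hzr] with w hw hw2 hw3
        rw [hw] at hw2
        exact (div_eq_zero_iff.1 hw2.symm).resolve_right (pow_ne_zero _ (sub_ne_zero.2 hw3))
    have hGT : zeroSet G U ⊆ T := by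
      rintro z ⟨hz, hz0⟩
      have hzr : z ≠ r := by
        rintro rfl
        rw [hGr.self_of_nhds] at hz0
        exact hg0 hz0
      have := hT ⟨hz, by rw [hFG z hz, hz0, mul_zero]⟩
      rw [Finset.coe_insert] at this
      exact this.resolve_left hzr
    obtain ⟨s, u, hs, hu, hu0, hGs⟩ := ih hGa hGtop hGT
    refine ⟨Multiset.replicate n r + s, u, ?_, hu, hu0, ?_⟩
    · intro w hw
      rcases Multiset.mem_add.1 hw with h | h
      · rwa [Multiset.eq_of_mem_replicate h]
      · exact hs w h
    · intro z hz
      rw [hFG z hz, hGs z hz]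
      simp [mul_assoc]

/-! ### Boundary behaviour in the disc -/

/-- The filter of points of the open unit disc tending to the unit circle. -/
noncomputable def circleWithin : Filter ℂ := comap norm (𝓝[<] (1 : ℝ))

lemma eventually_circleWithin {p : ℂ → Prop} :
    (∀ᶠ z in circleWithin, p z) ↔ ∃ ρ < 1, ∀ z : ℂ, ρ < ‖z‖ → ‖z‖ < 1 → p z := by
  rw [circleWithin, eventually_comap, Filter.Eventually,
    mem_nhdsLT_iff_exists_Ioo_subset' (show (0 : ℝ) < 1 by norm_num)]
  constructor
  · rintro ⟨ρ, hρ, h⟩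
    exact ⟨ρ, hρ, fun z h1 h2 => h ⟨h1, h2⟩ z rfl⟩
  · rintro ⟨ρ, hρ, h⟩
    refine ⟨ρ, hρ, ?_⟩
    rintro _ ⟨h1, h2⟩ z rfl
    exact h z h1 h2

lemma tendsto_norm_circleWithin : Tendsto (fun z : ℂ => ‖z‖) circleWithin (𝓝 1) :=
  tendsto_comap.mono_right nhdsWithin_le_nhds

lemma eventually_mem_ball_circleWithin : ∀ᶠ z in circleWithin, z ∈ ball (0 : ℂ) 1 :=
  eventually_circleWithin.2 ⟨0, one_pos, fun _ _ h => mem_ball_zero_iff.2 h⟩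

/-- The maximum principle, with the boundary values replaced by a limit condition. -/
lemma norm_le_of_tendsto_circleWithin {v : ℂ → ℂ} (hv : DifferentiableOn ℂ v (ball 0 1)) {c : ℝ}
    (hlim : Tendsto (fun z => ‖v z‖) circleWithin (𝓝 c)) {z : ℂ} (hz : z ∈ ball (0 : ℂ) 1) :
    ‖v z‖ ≤ c := by
  refine le_of_forall_pos_le_add fun ε hε => ?_
  obtain ⟨ρ, hρ, h⟩ := eventually_circleWithin.1
    (hlim.eventually (gt_mem_nhds (show c < c + ε by linarith)))
  rw [mem_ball_zero_iff] at hz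
  obtain ⟨t, ht1, ht2⟩ := exists_between (max_lt (max_lt hρ hz) one_pos)
  have ht0 : 0 < t := (le_max_right _ _).trans_lt ht1
  have htρ : ρ < t := ((le_max_left _ _).trans (le_max_left _ _)).trans_lt ht1
  have htz : ‖z‖ < t := ((le_max_right _ _).trans (le_max_left _ _)).trans_lt ht1
  have hcl : closure (ball (0 : ℂ) t) ⊆ ball 0 1 :=
    closure_ball_subset_closedBall.trans (closedBall_subset_ball ht2)
  refine norm_le_of_forall_mem_frontier_norm_le isBounded_ball (hv.mono hcl).diffContOnCl
    (fun w hw => ?_) (subset_closure (mem_ball_zero_iff.2 htz))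
  rw [frontier_ball _ ht0.ne', mem_sphere_zero_iff_norm] at hw
  exact (h w (hw ▸ htρ) (hw ▸ ht2)).le

/-- A nonvanishing holomorphic function on the disc whose modulus has a constant nonzero boundary
value is constant. -/
lemma exists_eq_const_of_tendsto_circleWithin {v : ℂ → ℂ} (hv : DifferentiableOn ℂ v (ball 0 1))
    (hv0 : ∀ z ∈ ball (0 : ℂ) 1, v z ≠ 0) {c : ℝ} (hc : 0 < c)
    (hlim : Tendsto (fun z => ‖v z‖) circleWithin (𝓝 c)) :
    ∀ z ∈ ball (0 : ℂ) 1, v z = v 0 := by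
  have h1 : ∀ z ∈ ball (0 : ℂ) 1, ‖v z‖ = c := by
    intro z hz
    refine le_antisymm (norm_le_of_tendsto_circleWithin hv hlim hz) ?_
    have h2 := norm_le_of_tendsto_circleWithin (v := fun z => (v z)⁻¹) (hv.inv hv0) (c := c⁻¹)
      (by simpa only [norm_inv] using hlim.inv₀ hc.ne') hz
    rw [norm_inv] at h2
    exact (inv_le_inv₀ (norm_pos_iff.2 (hv0 z hz)) hc).1 h2
  have h0 : (0 : ℂ) ∈ ball (0 : ℂ) 1 := mem_ball_self one_pos
  have hmax : IsMaxOn (norm ∘ v) (ball 0 1) 0 := fun z hz => by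
    simp [h1 z hz, h1 0 h0]
  exact eqOn_of_isPreconnected_of_isMaxOn_norm (convex_ball (0 : ℂ) 1).isPreconnected isOpen_ball
    hv h0 hmax

lemma tendsto_norm_mobius_circleWithin {a : ℂ} (ha : ‖a‖ < 1) :
    Tendsto (fun z => ‖mobius a z‖) circleWithin (𝓝 1) := by
  have hb : Tendsto (fun z : ℂ => 1 - (1 - ‖a‖ ^ 2) * (1 - ‖z‖ ^ 2) / (1 - ‖a‖) ^ 2) circleWithin
      (𝓝 1) := by
    have := ((((tendsto_norm_circleWithin.pow 2).const_sub 1).const_mul (1 - ‖a‖ ^ 2)).div_const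
      ((1 - ‖a‖) ^ 2)).const_sub 1
    simpa using this
  have hsq : Tendsto (fun z => ‖mobius a z‖ ^ 2) circleWithin (𝓝 1) := by
    refine tendsto_of_tendsto_of_tendsto_of_le_of_le' hb tendsto_const_nhds ?_ ?_
    · filter_upwards [eventually_mem_ball_circleWithin] with z hz
      rw [mem_ball_zero_iff] at hz
      have h0 := norm_pos_iff.2 (one_sub_conj_mul_ne_zero ha hz.le)
      have h1 := norm_one_sub_conj_mul_sq_sub a z
      have h2 : ‖mobius a z‖ ^ 2 = 1 - (1 - ‖a‖ ^ 2) * (1 - ‖z‖ ^ 2) / ‖1 - conj a * z‖ ^ 2 := by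
        rw [mobius, norm_div, div_pow, ← h1, sub_div, div_self (pow_ne_zero 2 h0.ne'),
          sub_sub_cancel]
      rw [h2]
      have h3 : 1 - ‖a‖ ≤ ‖1 - conj a * z‖ := by
        have h4 : ‖conj a * z‖ ≤ ‖a‖ := by
          rw [norm_mul, RCLike.norm_conj]
          exact mul_le_of_le_one_right (norm_nonneg _) hz.le
        have h5 := norm_sub_norm_le (1 : ℂ) (conj a * z)
        rw [norm_one] at h5
        linarith
      have h6 : 0 < 1 - ‖a‖ := by linarith
      have h7 : 0 ≤ (1 - ‖a‖ ^ 2) * (1 - ‖z‖ ^ 2) := by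
        apply mul_nonneg <;> nlinarith [norm_nonneg a, norm_nonneg z]
      gcongr
    · filter_upwards [eventually_mem_ball_circleWithin] with z hz
      exact pow_le_one₀ (norm_nonneg _) (norm_mobius_lt_one ha (mem_ball_zero_iff.1 hz)).le
  have := hsq.sqrt
  simpa using this

/-! ### Roots of polynomials in the disc -/

/-- The logarithmic derivative of `∏ (z - r)`, integrated over the unit circle, counts the `r` in
the disc. -/
lemma circleIntegral_sum_inv_sub (s : Multiset ℂ) (hs : ∀ r ∈ s, ‖r‖ ≠ 1) :
    CircleIntegrable (fun z => (s.map fun r => 1 / (z - r)).sum) 0 1 ∧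
    (∮ z in C(0, 1), (s.map fun r => 1 / (z - r)).sum) =
      2 * Real.pi * I * (s.countP fun r => ‖r‖ < 1) := by
  induction s using Multiset.induction_on with
  | empty => simp [circleIntegrable_const, circleIntegral]
  | cons r s ih =>
    obtain ⟨h1, h2⟩ := ih fun q hq => hs q (Multiset.mem_cons_of_mem hq)
    have hr : ‖r‖ ≠ 1 := hs r (Multiset.mem_cons_self r s)
    have hne : ∀ z ∈ sphere (0 : ℂ) 1, z - r ≠ 0 := by
      intro z hz h
      rw [sub_eq_zero] at h
      rw [mem_sphere_zero_iff_norm, h] at hz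
      exact hr hz
    have hci : CircleIntegrable (fun z => 1 / (z - r)) 0 1 := by
      apply ContinuousOn.circleIntegrable zero_le_one
      exact continuousOn_const.div (by fun_prop) hne
    simp only [Multiset.map_cons, Multiset.sum_cons, Multiset.countP_cons]
    refine ⟨hci.add h1, ?_⟩
    rw [circleIntegral.integral_add hci h1, h2]
    by_cases hlt : ‖r‖ < 1
    · have h3 : (∮ z in C(0, 1), 1 / (z - r)) = 2 * Real.pi * I := by
        simpa only [one_div] using
          circleIntegral.integral_sub_inv_of_mem_ball (mem_ball_zero_iff.2 hlt)
      rw [h3, if_pos hlt]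
      push_cast
      ring
    · have h3 : (∮ z in C(0, 1), 1 / (z - r)) = 0 := by
        refine DiffContOnCl.circleIntegral_eq_zero zero_le_one
          (DifferentiableOn.diffContOnCl fun z hz => ?_)
        have hz1 := closure_ball_subset_closedBall hz
        rw [mem_closedBall_zero_iff] at hz1
        have h4 : z - r ≠ 0 := by
          intro h
          rw [sub_eq_zero] at h
          rw [h] at hz1
          exact hr (le_antisymm hz1 (not_lt.1 hlt))
        have h5 : DifferentiableAt ℂ (fun z => z - r) z := by fun_prop
        exact ((differentiableAt_const (1 : ℂ)).fun_div h5 h4).differentiableWithinAt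
      rw [h3, if_neg hlt]
      simp

open Polynomial in
/-- If the quotient of two polynomials has a branch of the logarithm along the unit circle, they
have equally many roots in the disc. -/
lemma countP_roots_eq {p q : ℂ[X]} (hp : ∀ z : ℂ, ‖z‖ = 1 → p.eval z ≠ 0)
    (hq : ∀ z : ℂ, ‖z‖ = 1 → q.eval z ≠ 0)
    (hpq : ∀ z : ℂ, ‖z‖ = 1 → p.eval z / q.eval z ∈ slitPlane) :
    p.roots.countP (fun r => ‖r‖ < 1) = q.roots.countP (fun r => ‖r‖ < 1) := by
  have hr : ∀ {f : ℂ[X]}, (∀ z : ℂ, ‖z‖ = 1 → f.eval z ≠ 0) → ∀ r ∈ f.roots, ‖r‖ ≠ 1 :=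
    fun hf r hr h => hf r h (isRoot_of_mem_roots hr)
  obtain ⟨ip, ep⟩ := circleIntegral_sum_inv_sub p.roots (hr hp)
  obtain ⟨iq, eq⟩ := circleIntegral_sum_inv_sub q.roots (hr hq)
  have h0 : (∮ z in C(0, 1), ((p.roots.map fun r => 1 / (z - r)).sum -
      (q.roots.map fun r => 1 / (z - r)).sum)) = 0 := by
    refine circleIntegral.integral_eq_zero_of_hasDerivWithinAt
      (f := fun z => log (p.eval z / q.eval z))
      zero_le_one fun z hz => ?_
    rw [mem_sphere_zero_iff_norm] at hz
    -- the integrand is the derivative of `log (p / q)`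
    have h1 := ((p.hasDerivAt z).div (q.hasDerivAt z) (hq z hz)).clog (hpq z hz)
    refine (h1.congr_deriv ?_).hasDerivWithinAt
    rw [← (IsAlgClosed.splits p).eval_derivative_div_eval_of_ne_zero (hp z hz),
      ← (IsAlgClosed.splits q).eval_derivative_div_eval_of_ne_zero (hq z hz)]
    have := hp z hz
    have := hq z hz
    simp only [Pi.div_apply]
    field_simp
  rw [circleIntegral.integral_sub ip iq, ep, eq, ← mul_sub, mul_eq_zero,
    or_iff_right two_pi_I_ne_zero, sub_eq_zero] at h0
  exact_mod_cast h0

/-! ### Finite Blaschke products -/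

open Polynomial in
/-- The numerator `∏ (X - a)` of a finite Blaschke product. -/
noncomputable def blaschkeNum (s : Multiset ℂ) : ℂ[X] := (s.map fun a => X - C a).prod

open Polynomial in
/-- The denominator `∏ (1 - conj a X)` of a finite Blaschke product. -/
noncomputable def blaschkeDen (s : Multiset ℂ) : ℂ[X] := (s.map fun a => 1 - C (conj a) * X).prod

open Polynomial in
/-- The numerator of the derivative of a finite Blaschke product. -/
noncomputable def blaschkeWronskian (s : Multiset ℂ) : ℂ[X] :=
  derivative (blaschkeNum s) * blaschkeDen s - blaschkeNum s * derivative (blaschkeDen s)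

open Polynomial in
lemma eval_blaschkeNum (s : Multiset ℂ) (z : ℂ) :
    (blaschkeNum s).eval z = (s.map fun a => z - a).prod := by
  simp [blaschkeNum, eval_multiset_prod, Multiset.map_map]

open Polynomial in
lemma eval_blaschkeDen (s : Multiset ℂ) (z : ℂ) :
    (blaschkeDen s).eval z = (s.map fun a => 1 - conj a * z).prod := by
  simp [blaschkeDen, eval_multiset_prod, Multiset.map_map]

lemma eval_blaschkeDen_ne_zero {s : Multiset ℂ} (hs : ∀ a ∈ s, ‖a‖ < 1) {z : ℂ} (hz : ‖z‖ ≤ 1) :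
    (blaschkeDen s).eval z ≠ 0 := by
  rw [eval_blaschkeDen]
  refine Multiset.prod_ne_zero fun h => ?_
  obtain ⟨a, ha, h⟩ := Multiset.mem_map.1 h
  exact one_sub_conj_mul_ne_zero (hs a ha) hz h

lemma eval_blaschkeNum_ne_zero {s : Multiset ℂ} {z : ℂ} (hz : z ∉ s) :
    (blaschkeNum s).eval z ≠ 0 := by
  rw [eval_blaschkeNum]
  refine Multiset.prod_ne_zero fun h => hz ?_
  obtain ⟨a, ha, h⟩ := Multiset.mem_map.1 h
  rwa [sub_eq_zero.1 h]

open Polynomial in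
/-- On the unit circle `z B' / B` is a sum of Poisson kernels, where `B` is the Blaschke product;
in particular it is positive. -/
lemma eval_blaschkeWronskian (s : Multiset ℂ) (hs : ∀ a ∈ s, ‖a‖ < 1) {z : ℂ} (hz : ‖z‖ = 1) :
    z * (blaschkeWronskian s).eval z =
      ((s.map fun a => (1 - ‖a‖ ^ 2) / ‖z - a‖ ^ 2).sum : ℝ) *
        ((blaschkeNum s).eval z * (blaschkeDen s).eval z) := by
  induction s using Multiset.induction_on with
  | empty => simp [blaschkeWronskian, blaschkeNum, blaschkeDen]
  | cons a s ih =>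
    have ih := ih fun b hb => hs b (Multiset.mem_cons_of_mem hb)
    have ha := hs a (Multiset.mem_cons_self a s)
    have hza : z - a ≠ 0 := fun h => by
      rw [sub_eq_zero.1 h] at hz
      exact absurd ha (by rw [hz]; exact lt_irrefl 1)
    have hzz : z * conj z = 1 := by rw [mul_conj', hz]; simp
    -- on the circle `(z - a) (1 - conj a z) = z ‖z - a‖ ^ 2`
    have h1 : (z - a) * (1 - conj a * z) = z * (‖z - a‖ : ℂ) ^ 2 := by
      rw [← mul_conj', map_sub]
      linear_combination (-(z - a)) * hzz
    have h2 : (‖a‖ : ℂ) ^ 2 = conj a * a := (conj_mul' a).symm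
    have h3 : (‖z - a‖ : ℂ) ^ 2 ≠ 0 := pow_ne_zero 2 (by simpa using hza)
    have hN : blaschkeNum (a ::ₘ s) = (X - C a) * blaschkeNum s := by simp [blaschkeNum]
    have hD : blaschkeDen (a ::ₘ s) = (1 - C (conj a) * X) * blaschkeDen s := by simp [blaschkeDen]
    simp only [blaschkeWronskian, eval_sub, eval_mul] at ih
    simp only [blaschkeWronskian, hN, hD, Multiset.map_cons, Multiset.sum_cons, derivative_mul,
      derivative_sub, derivative_X, derivative_C, derivative_one, eval_sub, eval_mul, eval_add,
      eval_X, eval_C, eval_one, eval_zero]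
    push_cast
    rw [h2]
    set P := (blaschkeNum s).eval z
    set Q := (blaschkeDen s).eval z
    set P' := (derivative (blaschkeNum s)).eval z
    set Q' := (derivative (blaschkeDen s)).eval z
    set σ : ℂ := (((s.map fun a => (1 - ‖a‖ ^ 2) / ‖z - a‖ ^ 2).sum : ℝ) : ℂ)
    have h4 : (1 - conj a * a) / (‖z - a‖ : ℂ) ^ 2 * ((z - a) * (1 - conj a * z)) =
        (1 - conj a * a) * z := by
      rw [h1, mul_comm z, ← mul_assoc, div_mul_cancel₀ _ h3]
    linear_combination (z - a) * (1 - conj a * z) * ih - P * Q * h4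

/-- The count for a finite Blaschke product: one critical point less than zeros. -/
lemma countP_roots_blaschkeWronskian {s : Multiset ℂ} (hs : ∀ a ∈ s, ‖a‖ < 1) (hs0 : s ≠ 0) :
    blaschkeWronskian s ≠ 0 ∧
      (blaschkeWronskian s).roots.countP (fun r => ‖r‖ < 1) + 1 = s.card := by
  have hpos : ∀ z : ℂ, ‖z‖ = 1 → 0 < (s.map fun a => (1 - ‖a‖ ^ 2) / ‖z - a‖ ^ 2).sum := by
    intro z hz
    have hterm : ∀ a ∈ s, 0 < (1 - ‖a‖ ^ 2) / ‖z - a‖ ^ 2 := by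
      intro a ha
      have h1 := hs a ha
      have h2 : z - a ≠ 0 := fun h => by
        rw [sub_eq_zero.1 h] at hz
        linarith
      have h3 : 0 < 1 - ‖a‖ ^ 2 := by nlinarith [norm_nonneg a]
      have h4 := norm_pos_iff.2 h2
      positivity
    obtain ⟨a, ha⟩ := Multiset.exists_mem_of_ne_zero hs0
    have h5 := Multiset.single_le_sum (s := s.map fun a => (1 - ‖a‖ ^ 2) / ‖z - a‖ ^ 2) (by
      intro x hx
      obtain ⟨b, hb, rfl⟩ := Multiset.mem_map.1 hx
      exact (hterm b hb).le) _ (Multiset.mem_map_of_mem _ ha)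
    exact (hterm a ha).trans_le h5
  have hq : ∀ z : ℂ, ‖z‖ = 1 → (blaschkeNum s * blaschkeDen s).eval z ≠ 0 := by
    intro z hz
    rw [Polynomial.eval_mul]
    refine mul_ne_zero (eval_blaschkeNum_ne_zero fun h => ?_) (eval_blaschkeDen_ne_zero hs hz.le)
    have := hs z h
    linarith
  have hp : ∀ z : ℂ, ‖z‖ = 1 → (Polynomial.X * blaschkeWronskian s).eval z =
      ((s.map fun a => (1 - ‖a‖ ^ 2) / ‖z - a‖ ^ 2).sum : ℝ) *
        (blaschkeNum s * blaschkeDen s).eval z := by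
    intro z hz
    rw [Polynomial.eval_mul, Polynomial.eval_X, Polynomial.eval_mul, eval_blaschkeWronskian s hs hz]
  have hp0 : ∀ z : ℂ, ‖z‖ = 1 → (Polynomial.X * blaschkeWronskian s).eval z ≠ 0 := by
    intro z hz
    rw [hp z hz]
    exact mul_ne_zero (ofReal_ne_zero.2 (hpos z hz).ne') (hq z hz)
  -- compare `z B'` and `B`, both with the denominators cleared
  have hcount := countP_roots_eq hp0 hq (by
    intro z hz
    rw [hp z hz, mul_div_assoc, div_self (hq z hz), mul_one]
    exact ofReal_mem_slitPlane.2 (hpos z hz))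
  have hXW : Polynomial.X * blaschkeWronskian s ≠ 0 := fun h => by
    have := hp0 1 (by simp)
    simp [h] at this
  have hPQ : blaschkeNum s * blaschkeDen s ≠ 0 := fun h => by
    have := hq 1 (by simp)
    simp [h] at this
  refine ⟨right_ne_zero_of_mul hXW, ?_⟩
  rw [Polynomial.roots_mul hXW, Polynomial.roots_mul hPQ, Polynomial.roots_X, Multiset.countP_add,
    Multiset.countP_add] at hcount
  have h1 : Multiset.countP (fun r : ℂ => ‖r‖ < 1) {0} = 1 := by
    rw [← Multiset.cons_zero, Multiset.countP_cons]; simp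
  have h2 : (blaschkeNum s).roots = s := Polynomial.roots_multiset_prod_X_sub_C s
  have h3 : (blaschkeDen s).roots.countP (fun r => ‖r‖ < 1) = 0 := by
    rw [Multiset.countP_eq_zero]
    intro r hr hr1
    exact eval_blaschkeDen_ne_zero hs hr1.le (Polynomial.isRoot_of_mem_roots hr)
  have h4 : s.countP (fun r => ‖r‖ < 1) = s.card := Multiset.countP_eq_card.2 hs
  rw [h1, h2, h3, h4] at hcount
  omega

/-- A function on the disc whose modulus tends to a positive constant at the circle is a constant
multiple of a finite Blaschke product. -/
theorem exists_eq_blaschke {g : ℂ → ℂ} (hg : DifferentiableOn ℂ g (ball 0 1)) {c : ℝ} (hc : 0 < c)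
    (hlim : Tendsto (fun z => ‖g z‖) circleWithin (𝓝 c)) :
    ∃ (s : Multiset ℂ) (b : ℂ), b ≠ 0 ∧ (∀ a ∈ s, ‖a‖ < 1) ∧
      ∀ z ∈ ball (0 : ℂ) 1, g z = b * ((blaschkeNum s).eval z / (blaschkeDen s).eval z) := by
  have hga : AnalyticOnNhd ℂ g (ball 0 1) := hg.analyticOnNhd isOpen_ball
  obtain ⟨ρ, hρ, hρ'⟩ := eventually_circleWithin.1 (hlim.eventually (lt_mem_nhds hc))
  have hgne : ∀ z : ℂ, ρ < ‖z‖ → ‖z‖ < 1 → g z ≠ 0 := fun z h1 h2 => norm_pos_iff.1 (hρ' z h1 h2)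
  have hnz : ∃ z ∈ ball (0 : ℂ) 1, g z ≠ 0 := by
    obtain ⟨t, ht1, ht2⟩ := exists_between (max_lt hρ one_pos)
    have ht0 : 0 < t := (le_max_right _ _).trans_lt ht1
    have htn : ‖(t : ℂ)‖ = t := by simp [ht0.le]
    exact ⟨t, by rw [mem_ball_zero_iff, htn]; exact ht2,
      hgne t (by rw [htn]; exact (le_max_left _ _).trans_lt ht1) (by rw [htn]; exact ht2)⟩
  obtain ⟨z₀, hz₀, hz₀g⟩ := hnz
  have hpre : IsPreconnected (ball (0 : ℂ) 1) := (convex_ball _ _).isPreconnected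
  have htop : ∀ z ∈ ball (0 : ℂ) 1, analyticOrderAt g z ≠ ⊤ := by
    intro z hz h
    rw [analyticOrderAt_eq_top] at h
    exact hz₀g (hga.eqOn_zero_of_preconnected_of_eventuallyEq_zero hpre hz h hz₀)
  have hsub : zeroSet g (ball 0 1) ⊆ closedBall 0 ρ := by
    rintro z ⟨hz, hz0⟩
    rw [mem_closedBall_zero_iff]
    by_contra! h
    exact hgne z h (mem_ball_zero_iff.1 hz) hz0
  have hfin : (zeroSet g (ball 0 1)).Finite := by
    by_contra hinf
    obtain ⟨x, hx, hacc⟩ := Set.Infinite.exists_accPt_of_subset_isCompact hinf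
      (isCompact_closedBall 0 ρ) hsub
    rw [accPt_iff_frequently_nhdsNE] at hacc
    have := hga.eqOn_zero_of_preconnected_of_frequently_eq_zero hpre
      (closedBall_subset_ball hρ hx) (hacc.mono fun z hz => hz.2)
    exact hz₀g (this hz₀)
  obtain ⟨s, u, hs, hu, hu0, hgs⟩ := exists_factorization hfin.toFinset hga htop (by simp)
  have hs1 : ∀ a ∈ s, ‖a‖ < 1 := fun a ha => mem_ball_zero_iff.1 (hs a ha)
  -- `v` is the quotient of `g` by the Blaschke product with the same zeros
  let v : ℂ → ℂ := fun z => u z * (blaschkeDen s).eval z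
  have hQ : ∀ z ∈ ball (0 : ℂ) 1, (blaschkeDen s).eval z ≠ 0 := fun z hz =>
    eval_blaschkeDen_ne_zero hs1 (mem_ball_zero_iff.1 hz).le
  have hvd : DifferentiableOn ℂ v (ball 0 1) :=
    hu.differentiableOn.mul (blaschkeDen s).differentiableOn
  have hv0 : ∀ z ∈ ball (0 : ℂ) 1, v z ≠ 0 := fun z hz => mul_ne_zero (hu0 z hz) (hQ z hz)
  have hgv : ∀ z ∈ ball (0 : ℂ) 1,
      g z = v z * ((blaschkeNum s).eval z / (blaschkeDen s).eval z) := by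
    intro z hz
    have := hQ z hz
    rw [hgs z hz, eval_blaschkeNum]
    simp only [v]
    field_simp
  have hB : ∀ t : Multiset ℂ, (∀ a ∈ t, ‖a‖ < 1) →
      Tendsto (fun z => ‖(blaschkeNum t).eval z / (blaschkeDen t).eval z‖) circleWithin (𝓝 1) := by
    intro t
    induction t using Multiset.induction_on with
    | empty => simpa [blaschkeNum, blaschkeDen] using tendsto_const_nhds
    | cons a t ih =>
      intro h
      have h1 := (tendsto_norm_mobius_circleWithin (h a (Multiset.mem_cons_self a t))).mul
        (ih fun b hb => h b (Multiset.mem_cons_of_mem hb))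
      rw [mul_one] at h1
      refine h1.congr fun z => ?_
      rw [← norm_mul]
      simp only [eval_blaschkeNum, eval_blaschkeDen, mobius, Multiset.map_cons, Multiset.prod_cons]
      rw [div_mul_div_comm]
  have hvlim : Tendsto (fun z => ‖v z‖) circleWithin (𝓝 c) := by
    have h1 := hlim.div (hB s hs1) one_ne_zero
    rw [div_one] at h1
    refine h1.congr' ?_
    filter_upwards [(hB s hs1).eventually (lt_mem_nhds one_pos), eventually_mem_ball_circleWithin]
      with z h2 hz
    rw [Pi.div_apply, hgv z hz, norm_mul, mul_div_assoc, div_self h2.ne', mul_one]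
  refine ⟨s, v 0, hv0 0 (mem_ball_self one_pos), hs1, fun z hz => ?_⟩
  rw [hgv z hz, exists_eq_const_of_tendsto_circleWithin hvd hv0 hc hvlim z hz]

/-- A nonconstant function on the disc whose modulus tends to a positive constant at the circle has
one zero more than its derivative. -/
theorem zeroCount_ball {g : ℂ → ℂ} (hg : DifferentiableOn ℂ g (ball 0 1)) {c : ℝ} (hc : 0 < c)
    (hlim : Tendsto (fun z => ‖g z‖) circleWithin (𝓝 c))
    (hnc : ¬ ∃ b : ℂ, ∀ z ∈ ball (0 : ℂ) 1, g z = b) :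
    (zeroSet g (ball 0 1)).Finite ∧ (zeroSet (deriv g) (ball 0 1)).Finite ∧
      zeroCount g (ball 0 1) = zeroCount (deriv g) (ball 0 1) + 1 := by
  obtain ⟨s, b, hb, hs, hgb⟩ := exists_eq_blaschke hg hc hlim
  have hs0 : s ≠ 0 := by
    rintro rfl
    exact hnc ⟨b, fun z hz => by rw [hgb z hz]; simp [blaschkeNum, blaschkeDen]⟩
  obtain ⟨hW, hcount⟩ := countP_roots_blaschkeWronskian hs hs0
  have hQ : ∀ z ∈ ball (0 : ℂ) 1, (blaschkeDen s).eval z ≠ 0 := fun z hz =>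
    eval_blaschkeDen_ne_zero hs (mem_ball_zero_iff.1 hz).le
  have hpa : ∀ p : Polynomial ℂ, AnalyticOnNhd ℂ (fun z => p.eval z) (ball 0 1) := fun p =>
    p.differentiable.differentiableOn.analyticOnNhd isOpen_ball
  have hfin : ∀ t : Multiset ℂ, {z | z ∈ t}.Finite := fun t =>
    t.toFinset.finite_toSet.subset fun z hz => by simpa using hz
  have hg1 := zeroSet_zeroCount_of_factorization isOpen_ball (F := g) (s := s)
    (u := fun z => b / (blaschkeDen s).eval z) (fun a ha => mem_ball_zero_iff.2 (hs a ha))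
    (analyticOnNhd_const.div (hpa _) hQ) (fun z hz => div_ne_zero hb (hQ z hz)) (by
      intro z hz
      rw [hgb z hz, eval_blaschkeNum]
      ring)
  set W := blaschkeWronskian s with hWdef
  have hderiv : ∀ z ∈ ball (0 : ℂ) 1,
      deriv g z = b * (W.eval z / (blaschkeDen s).eval z ^ 2) := by
    intro z hz
    have h1 : HasDerivAt (fun z => b * ((blaschkeNum s).eval z / (blaschkeDen s).eval z)) _ z :=
      (((blaschkeNum s).hasDerivAt z).fun_div ((blaschkeDen s).hasDerivAt z) (hQ z hz)).const_mul b
    have h2 : g =ᶠ[𝓝 z] fun z => b * ((blaschkeNum s).eval z / (blaschkeDen s).eval z) := by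
      filter_upwards [isOpen_ball.mem_nhds hz] with w hw using hgb w hw
    rw [h2.deriv_eq, h1.deriv, hWdef, blaschkeWronskian]
    simp
  let t := W.roots.filter fun r => ‖r‖ < 1
  let t' := W.roots.filter fun r => ¬ ‖r‖ < 1
  have hWe : ∀ z, W.eval z =
      W.leadingCoeff * ((t.map fun r => z - r).prod * (t'.map fun r => z - r).prod) := by
    intro z
    rw [(IsAlgClosed.splits W).eval_eq_prod_roots, ← Multiset.prod_add, ← Multiset.map_add,
      Multiset.filter_add_not]
  have hg2 := zeroSet_zeroCount_of_factorization isOpen_ball (F := deriv g) (s := t)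
    (u := fun z => b * W.leadingCoeff * (t'.map fun r => z - r).prod / (blaschkeDen s).eval z ^ 2)
    (fun a ha => mem_ball_zero_iff.2 (Multiset.mem_filter.1 ha).2)
    ((analyticOnNhd_const.mul fun z _ => analyticAt_prod_sub t' z).div ((hpa _).pow 2)
      fun z hz => pow_ne_zero 2 (hQ z hz))
    (by
      intro z hz
      refine div_ne_zero (mul_ne_zero (mul_ne_zero hb (Polynomial.leadingCoeff_ne_zero.2 hW)) ?_)
        (pow_ne_zero 2 (hQ z hz))
      refine Multiset.prod_ne_zero fun h => ?_
      obtain ⟨r, hr, h⟩ := Multiset.mem_map.1 h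
      apply (Multiset.mem_filter.1 hr).2
      rw [← sub_eq_zero.1 h]
      exact mem_ball_zero_iff.1 hz)
    (by
      intro z hz
      rw [hderiv z hz, hWe]
      ring)
  refine ⟨hg1.1 ▸ hfin s, hg2.1 ▸ hfin t, ?_⟩
  rw [hg1.2, hg2.2, ← hcount, Multiset.countP_eq_card_filter]

/-! ### Transport to the disc -/

/-- Zero counts are invariant under a bijective change of variable which preserves zeros and orders
of vanishing. -/
lemma zeroSet_finite_and_zeroCount_eq_of_bijOn {D E : Set ℂ} {φ F G : ℂ → ℂ} (hφ : BijOn φ D E)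
    (h0 : ∀ z ∈ D, (F z = 0 ↔ G (φ z) = 0))
    (hord : ∀ z ∈ D, analyticOrderAt F z = analyticOrderAt G (φ z))
    (hfin : (zeroSet G E).Finite) : (zeroSet F D).Finite ∧ zeroCount F D = zeroCount G E := by
  have hbij : BijOn φ (zeroSet F D) (zeroSet G E) := by
    refine ⟨fun z hz => ⟨hφ.mapsTo hz.1, (h0 z hz.1).1 hz.2⟩,
      hφ.injOn.mono fun z hz => hz.1, ?_⟩
    rintro w ⟨hw, hw0⟩
    obtain ⟨z, hz, rfl⟩ := hφ.surjOn hw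
    exact ⟨z, ⟨hz, (h0 z hz).2 hw0⟩, rfl⟩
  refine ⟨hbij.finite_iff_finite.2 hfin, finsum_mem_eq_of_bijOn φ hbij fun z hz => ?_⟩
  rw [analyticOrderNatAt, hord z hz.1, analyticOrderNatAt]

end Macdonald

open Set Filter Topology Metric Macdonald in
theorem mainTheorem1 (Γ D : Set ℂ) (f : ℂ → ℂ) (C : ℝ)
    (hΓ : Macdonald.IsContour Γ) (hD : Macdonald.IsRegionEnclosedBy D Γ)
    (hf : AnalyticOnNhd ℂ f D) (hcont : ContinuousOn f (D ∪ Γ))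
    (hnonconst : ¬ ∃ c : ℂ, ∀ z ∈ D, f z = c)
    (hC : ∀ z ∈ Γ, ‖f z‖ = C) :
    (Macdonald.zeroSet f D).Finite ∧ (Macdonald.zeroSet (deriv f) D).Finite ∧
      Macdonald.zeroCount f D = Macdonald.zeroCount (deriv f) D + 1 := by
  obtain ⟨γ, hγ, -, rfl⟩ := hΓ
  obtain ⟨⟨a, haΓ, hDa⟩, hDb⟩ := hD
  set Γ := range γ
  have hΓK : IsCompact Γ := isCompact_range hγ
  have hΓn : Γ.Nonempty := range_nonempty γ
  have hΓp : IsPreconnected Γ := isPreconnected_range hγ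
  have ha : a ∈ D := hDa ▸ mem_connectedComponentIn haΓ
  have hDo : IsOpen D := hDa ▸ hΓK.isClosed.isOpen_compl.connectedComponentIn
  have hDp : IsPreconnected D := hDa ▸ isPreconnected_connectedComponentIn
  have hDc : IsPreconnected Dᶜ :=
    hDa ▸ isPreconnected_compl_component hΓK.isClosed hΓp hΓn a
  have hcl : closure D ⊆ D ∪ Γ := hDa ▸ closure_component_subset hΓK.isClosed a
  have hDΓ : IsCompact (D ∪ Γ) := by
    have : D ∪ Γ = closure D ∪ Γ :=
      (union_subset_union_left _ subset_closure).antisymm (union_subset hcl subset_union_right)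
    rw [this]
    exact hDb.isCompact_closure.union hΓK
  obtain ⟨φ, hφ, hφs⟩ := exists_isDiscEmbedding_bijOn hDo hDp hDb ha
    fun h hh hh0 => exists_sq_eq hDo hDp hDb hDc hh hh0
  have hbij : BijOn φ D (ball 0 1) := ⟨hφ.mapsTo, hφ.injOn, hφs⟩
  have hφa : AnalyticOnNhd ℂ φ D := hφ.differentiableOn.analyticOnNhd hDo
  let ψ := Function.invFunOn φ D
  have hψ : ∀ z ∈ D, ψ (φ z) = z := fun z hz => hbij.injOn.leftInvOn_invFunOn hz
  let g : ℂ → ℂ := f ∘ ψ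
  -- `g = f ∘ φ⁻¹` is only accessible through `g ∘ φ = f`; as `φ' ≠ 0`, this determines its
  -- analyticity and its orders of vanishing
  have hgφ : ∀ z ∈ D, g ∘ φ =ᶠ[𝓝 z] f := by
    intro z hz
    filter_upwards [hDo.mem_nhds hz] with w hw
    simp only [g, Function.comp_apply, hψ w hw]
  have hga : AnalyticOnNhd ℂ g (ball 0 1) := by
    intro w hw
    obtain ⟨z, hz, rfl⟩ := hφs hw
    exact (analyticAt_comp_iff_of_deriv_ne_zero (hφa z hz) (hφ.deriv_ne_zero z hz)).1
      ((hf z hz).congr (hgφ z hz).symm)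
  -- the points where `‖f‖` is not `ε`-close to `C` form a compact subset of `D`, whose image under
  -- `φ` stays away from the unit circle
  have hlim : Tendsto (fun w => ‖g w‖) circleWithin (𝓝 C) := by
    rw [Metric.tendsto_nhds]
    intro ε hε
    rw [eventually_circleWithin]
    let K : Set ℂ := (D ∪ Γ) ∩ {z | ε ≤ dist ‖f z‖ C}
    have hKc : IsCompact K := by
      refine hDΓ.of_isClosed_subset ?_ inter_subset_left
      exact (continuous_dist.comp_continuousOn
        (hcont.norm.prodMk continuousOn_const)).preimage_isClosed_of_isClosed hDΓ.isClosed (isClosed_Ici (a := ε))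
    have hKD : K ⊆ D := by
      rintro z ⟨hz | hz, hz2⟩
      · exact hz
      · have h : ε ≤ dist ‖f z‖ C := hz2
        rw [hC z hz, dist_self] at h
        linarith
    obtain ⟨ρ, hρ, hρK⟩ : ∃ ρ < 1, ∀ z ∈ K, ‖φ z‖ ≤ ρ := by
      rcases K.eq_empty_or_nonempty with h | h
      · exact ⟨0, one_pos, by simp [h]⟩
      · obtain ⟨m, hm, hmax⟩ :=
          hKc.exists_isMaxOn h (hφ.differentiableOn.continuousOn.mono hKD).norm
        exact ⟨‖φ m‖, mem_ball_zero_iff.1 (hφ.mapsTo (hKD hm)), fun z hz => hmax hz⟩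
    refine ⟨ρ, hρ, fun w hw1 hw2 => ?_⟩
    obtain ⟨z, hz, rfl⟩ := hφs (mem_ball_zero_iff.2 hw2)
    have hgz : g (φ z) = f z := (hgφ z hz).self_of_nhds
    rw [hgz]
    by_contra! h
    exact absurd (hρK z ⟨Or.inl hz, h⟩) (not_le.2 hw1)
  have hgD : DifferentiableOn ℂ g (ball 0 1) := hga.differentiableOn
  have hgnc : ¬ ∃ b : ℂ, ∀ w ∈ ball (0 : ℂ) 1, g w = b := by
    rintro ⟨b, hb⟩
    exact hnonconst ⟨b, fun z hz =>
      (hgφ z hz).self_of_nhds ▸ hb (φ z) (hφ.mapsTo hz)⟩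
  have hC0 : 0 < C := by
    obtain ⟨b, hb⟩ := hΓn
    refine (hC b hb ▸ norm_nonneg (f b)).lt_of_ne' fun h => hgnc ⟨0, fun w hw => ?_⟩
    exact norm_le_zero_iff.1 (norm_le_of_tendsto_circleWithin hgD (h ▸ hlim) hw)
  obtain ⟨h1, h2, h3⟩ := zeroCount_ball hgD hC0 hlim hgnc
  have hderiv : ∀ z ∈ D, deriv f =ᶠ[𝓝 z] (deriv g ∘ φ) * deriv φ := by
    intro z hz
    filter_upwards [hDo.mem_nhds hz] with w hw
    rw [← (hgφ w hw).deriv_eq]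
    exact deriv_comp w (hga (φ w) (hφ.mapsTo hw)).differentiableAt
      (hφa w hw).differentiableAt
  obtain ⟨f1, f2⟩ := zeroSet_finite_and_zeroCount_eq_of_bijOn hbij (F := f) (G := g)
    (fun z hz => by rw [← (hgφ z hz).self_of_nhds]; rfl)
    (fun z hz => by
      rw [← analyticOrderAt_congr (hgφ z hz),
        analyticOrderAt_comp_of_deriv_ne_zero (hφa z hz) (hφ.deriv_ne_zero z hz)]) h1
  obtain ⟨f3, f4⟩ := zeroSet_finite_and_zeroCount_eq_of_bijOn hbij (F := deriv f) (G := deriv g)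
    (fun z hz => by
      rw [(hderiv z hz).self_of_nhds]
      simp [hφ.deriv_ne_zero z hz])
    (fun z hz => by
      have hg' : AnalyticAt ℂ (deriv g) (φ z) := (hga (φ z) (hφ.mapsTo hz)).deriv
      rw [analyticOrderAt_congr (hderiv z hz),
        analyticOrderAt_mul (hg'.comp (hφa z hz)) (hφa z hz).deriv,
        analyticOrderAt_comp_of_deriv_ne_zero (hφa z hz) (hφ.deriv_ne_zero z hz),
        (hφa z hz).deriv.analyticOrderAt_eq_zero.2 (hφ.deriv_ne_zero z hz), add_zero]) h2
  exact ⟨f1, f3, by rw [f2, f4, h3]⟩
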